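/- Let $X\neq\{0\}$ be a complex Banach space, $\mathbb{R}_+=[0,\infty)$, and let $\{U(t,\tau)\}_{t\ge\tau\ge0}$ be an exponentially bounded evolution family on $X$, i.e. a family of bounded linear operators on $X$ such that $U(t,t)=I$ and $U(t,\tau)=U(t,s)U(s,\tau)$ for $t\ge s\ge\tau\ge0$, the map $(t,\tau)\mapsto U(t,\tau)x$ is continuous on $\{t\ge\tau\ge0\}$ for each $x\in X$, and $\|U(t,\tau)\|\le Me^{\omega(t-\tau)}$ for all $t\ge\tau\ge0$, with some constants $M\ge1$, $\omega\in\mathbb{R}$. Let $\mathcal{F}$ denote either $C_{00}(\mathbb{R}_+,X)$, the space of continuous functions $f:\mathbb{R}_+\to X$ vanishing at infinity with $f(0)=0$ (with the supremum norm), or $L^p(\mathbb{R}_+,X)$ with $1\le p<\infty$. Let $\{E^t\}_{t\ge0}$ be the evolution semigroup on $\mathcal{F}$ given by $$(E^tf)(\tau)=\begin{cases}U(\tau,\tau-t)f(\tau-t),&0\le t\le\tau,\\0,&0\le\tau<t,\end{cases}$$ and let $\Gamma$ be its infinitesimal generator. Then: 1. the spectrum of $\Gamma$ is a closed left half-plane,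 possibly empty: there is $s\in[-\infty,\infty)$ such that $\sigma(\Gamma)=\{\lambda\in\mathbb{C}:\operatorname{Re}\lambda\le s\}$ (which is $\emptyset$ if $s=-\infty$); 2. for every $t>0$ the spectrum $\sigma(E^t)$ is a closed disk $\{z\in\mathbb{C}:|z|\le r\}$ centered at the origin, with some $r=r(t)\ge0$ (if $r=0$, the disk is $\{0\}$); 3. for every $t>0$, $\;e^{t\sigma(\Gamma)}=\sigma(E^t)\setminus\{0\}$. -/

import Mathlib

open MeasureTheory Filter Topology
open scoped NNReal ENNReal ZeroAtInfty

noncomputable section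

namespace EvolutionSemigroup

/-! ### Strongly continuous semigroups: generator and spectrum -/

section Generator

variable {F : Type*} [NormedAddCommGroup F] [NormedSpace ℂ F]

/-- The difference quotient `(T h x - x) / h` of a one-parameter family of operators. -/
def diffQuot (T : ℝ≥0 → F →L[ℂ] F) (x : F) (h : ℝ≥0) : F :=
  (((h : ℝ) : ℂ)⁻¹) • (T h x - x)

theorem diffQuot_add (T : ℝ≥0 → F →L[ℂ] F) (x y : F) :
    diffQuot T (x + y) = fun h => diffQuot T x h + diffQuot T y h := by
  funext h
  simp only [diffQuot, map_add]
  rw [← smul_add]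
  congr 1
  abel

theorem diffQuot_smul (T : ℝ≥0 → F →L[ℂ] F) (c : ℂ) (x : F) :
    diffQuot T (c • x) = fun h => c • diffQuot T x h := by
  funext h
  simp only [diffQuot, map_smul]
  rw [← smul_sub, smul_comm]

/-- The domain of the generator: all `x` for which `(T h x - x) / h` converges in norm
as `h → 0+`. -/
def generatorDomain (T : ℝ≥0 → F →L[ℂ] F) : Submodule ℂ F where
  carrier := {x | ∃ y, Tendsto (diffQuot T x) (𝓝[>] 0) (𝓝 y)}
  zero_mem' := ⟨0, by
    have : diffQuot T (0 : F) = fun _ => 0 := by funext h; simp [diffQuot]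
    rw [this]; exact tendsto_const_nhds⟩
  add_mem' := by
    rintro x y ⟨a, ha⟩ ⟨b, hb⟩
    exact ⟨a + b, by rw [diffQuot_add]; exact ha.add hb⟩
  smul_mem' := by
    rintro c x ⟨a, ha⟩
    exact ⟨c • a, by rw [diffQuot_smul]; exact ha.const_smul c⟩

/-- The (infinitesimal) generator `Γ x = lim_{h → 0+} (T h x - x) / h` of a one-parameter
family of operators, with its maximal domain. -/
def generator (T : ℝ≥0 → F →L[ℂ] F) : F →ₗ.[ℂ] F where
  domain := generatorDomain T
  toFun :=
    { toFun := fun x => Classical.choose x.2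
      map_add' := fun x y => by
        refine tendsto_nhds_unique (Classical.choose_spec (x + y).2) ?_
        have := (Classical.choose_spec x.2).add (Classical.choose_spec y.2)
        rwa [← diffQuot_add] at this
      map_smul' := fun c x => by
        refine tendsto_nhds_unique (Classical.choose_spec (c • x).2) ?_
        have := (Classical.choose_spec x.2).const_smul c
        rwa [← diffQuot_smul] at this }

theorem mem_generator_domain {T : ℝ≥0 → F →L[ℂ] F} {x : F} :
    x ∈ (generator T).domain ↔ ∃ y, Tendsto (diffQuot T x) (𝓝[>] 0) (𝓝 y) := Iff.rfl

theorem tendsto_generator (T : ℝ≥0 → F →L[ℂ] F) (x : (generator T).domain) :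
    Tendsto (diffQuot T x) (𝓝[>] 0) (𝓝 (generator T x)) :=
  Classical.choose_spec x.2

/-- The resolvent set of an (in general unbounded) operator `A`, relative to `F →L[ℂ] F`: all `z`
such that `z - A : Dom A → F` is bijective with a bounded inverse `R`. -/
def operatorResolventSet (A : F →ₗ.[ℂ] F) : Set ℂ :=
  {z | ∃ R : F →L[ℂ] F,
    (∀ y : F, ∃ h : R y ∈ A.domain, z • R y - A ⟨R y, h⟩ = y) ∧
    (∀ x : A.domain, R (z • (x : F) - A x) = x)}

/-- The spectrum of an (in general unbounded) operator. -/
def operatorSpectrum (A : F →ₗ.[ℂ] F) : Set ℂ := (operatorResolventSet A)ᶜ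

end Generator

/-! ### Evolution families on the half-line -/

/-- An evolution family `{U(t,τ)}_{t ≥ τ ≥ 0}` of bounded operators on `X`
(the values `U t τ` with `t < τ` are irrelevant). -/
structure EvolutionFamily (X : Type*) [NormedAddCommGroup X] [NormedSpace ℂ X] where
  /-- the operators `U(t,τ)` -/
  U : ℝ≥0 → ℝ≥0 → X →L[ℂ] X
  comp : ∀ t s τ, τ ≤ s → s ≤ t → U t τ = (U t s).comp (U s τ)
  refl : ∀ t, U t t = ContinuousLinearMap.id ℂ X
  continuousOn : ∀ x : X,
    ContinuousOn (fun q : ℝ≥0 × ℝ≥0 => U q.1 q.2 x) {q | q.2 ≤ q.1}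

variable {X : Type*} [NormedAddCommGroup X] [NormedSpace ℂ X]

/-- Exponential boundedness of an evolution family. -/
def EvolutionFamily.ExponentiallyBounded (𝒰 : EvolutionFamily X) : Prop :=
  ∃ M ω : ℝ, 1 ≤ M ∧ ∀ t τ : ℝ≥0, τ ≤ t → ‖𝒰.U t τ‖ ≤ M * Real.exp (ω * ((t : ℝ) - τ))

/-- The function `E^t f` for an arbitrary function `f : ℝ₊ → X`:
`(E^t f)(τ) = U(τ, τ - t) f(τ - t)` for `t ≤ τ` and `(E^t f)(τ) = 0` for `τ < t`. -/
def evolFun (𝒰 : EvolutionFamily X) (t : ℝ≥0) (f : ℝ≥0 → X) : ℝ≥0 → X :=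
  fun τ => if t ≤ τ then 𝒰.U τ (τ - t) (f (τ - t)) else 0

theorem evolFun_add (𝒰 : EvolutionFamily X) (t : ℝ≥0) (f g : ℝ≥0 → X) :
    evolFun 𝒰 t (f + g) = evolFun 𝒰 t f + evolFun 𝒰 t g := by
  funext τ
  by_cases h : t ≤ τ <;> simp [evolFun, h]

theorem evolFun_smul (𝒰 : EvolutionFamily X) (t : ℝ≥0) (c : ℂ) (f : ℝ≥0 → X) :
    evolFun 𝒰 t (c • f) = c • evolFun 𝒰 t f := by
  funext τ
  by_cases h : t ≤ τ <;> simp [evolFun, h]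

theorem exists_bound {𝒰 : EvolutionFamily X} (h𝒰 : 𝒰.ExponentiallyBounded) (t : ℝ≥0) :
    ∃ C : ℝ≥0, ∀ σ : ℝ≥0, ‖𝒰.U (σ + t) σ‖ ≤ C := by
  obtain ⟨M, ω, hM, h⟩ := h𝒰
  refine ⟨(M * Real.exp (ω * t)).toNNReal, fun σ => (h (σ + t) σ le_self_add).trans ?_⟩
  rw [Real.coe_toNNReal _ (by positivity)]
  simp

theorem continuous_step {𝒰 : EvolutionFamily X} (h𝒰 : 𝒰.ExponentiallyBounded) (t : ℝ≥0) :
    Continuous fun q : ℝ≥0 × X => 𝒰.U (q.1 + t) q.1 q.2 := by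
  obtain ⟨C, hC⟩ := exists_bound h𝒰 t
  have hs : ∀ x : X, Continuous fun σ : ℝ≥0 => 𝒰.U (σ + t) σ x := fun x =>
    (𝒰.continuousOn x).comp_continuous (f := fun σ : ℝ≥0 => (σ + t, σ)) (by fun_prop)
      (fun σ => by simp)
  rw [continuous_iff_continuousAt]
  rintro ⟨σ₀, x₀⟩
  have h1 : Tendsto (fun q : ℝ≥0 × X => 𝒰.U (q.1 + t) q.1 (q.2 - x₀)) (𝓝 (σ₀, x₀)) (𝓝 0) := by
    have hb : Tendsto (fun q : ℝ≥0 × X => (C : ℝ) * ‖q.2 - x₀‖) (𝓝 (σ₀, x₀)) (𝓝 0) := by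
      have : Continuous fun q : ℝ≥0 × X => (C : ℝ) * ‖q.2 - x₀‖ := by fun_prop
      simpa using this.tendsto (σ₀, x₀)
    refine squeeze_zero_norm (fun q => ?_) hb
    exact ContinuousLinearMap.le_of_opNorm_le _ (hC q.1) _
  have h2 : Tendsto (fun q : ℝ≥0 × X => 𝒰.U (q.1 + t) q.1 x₀) (𝓝 (σ₀, x₀))
      (𝓝 (𝒰.U (σ₀ + t) σ₀ x₀)) :=
    ((hs x₀).comp continuous_fst).tendsto (σ₀, x₀)
  have h3 := h1.add h2
  simp only [map_sub, sub_add_cancel, zero_add] at h3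
  exact h3

theorem evolFun_eq_indicator (𝒰 : EvolutionFamily X) (t : ℝ≥0) (f : ℝ≥0 → X) :
    evolFun 𝒰 t f = (Set.Ici t).indicator
      ((fun σ => 𝒰.U (σ + t) σ (f σ)) ∘ fun τ => τ - t) := by
  funext τ
  by_cases h : t ≤ τ
  · simp [evolFun, h, tsub_add_cancel_of_le h]
  · simp [evolFun, h]

/-! ### The evolution semigroup on `C₀₀(ℝ₊, X)` -/

/-- `C₀₀(ℝ₊, X)`: continuous functions `f : ℝ₊ → X` that vanish at infinity and satisfy `f 0 = 0`,
with the supremum norm. -/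
def C00 (X : Type*) [NormedAddCommGroup X] [NormedSpace ℂ X] : Submodule ℂ C₀(ℝ≥0, X) where
  carrier := {f | f 0 = 0}
  zero_mem' := rfl
  add_mem' := by
    intro f g (hf : f 0 = 0) (hg : g 0 = 0)
    change f 0 + g 0 = 0
    rw [hf, hg, add_zero]
  smul_mem' := by
    intro c f (hf : f 0 = 0)
    change c • f 0 = 0
    rw [hf, smul_zero]

theorem evolFun_eq_comp (𝒰 : EvolutionFamily X) (t : ℝ≥0) {f : ℝ≥0 → X} (hf : f 0 = 0) :
    evolFun 𝒰 t f = (fun σ => 𝒰.U (σ + t) σ (f σ)) ∘ fun τ => τ - t := by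
  funext τ
  by_cases h : t ≤ τ
  · simp [evolFun, h, tsub_add_cancel_of_le h]
  · have h' : τ - t = 0 := tsub_eq_zero_of_le (not_le.1 h).le
    simp [evolFun, h, h', hf]

theorem continuous_evolFun {𝒰 : EvolutionFamily X} (h𝒰 : 𝒰.ExponentiallyBounded) (t : ℝ≥0)
    {f : ℝ≥0 → X} (hf : Continuous f) (hf0 : f 0 = 0) : Continuous (evolFun 𝒰 t f) := by
  rw [evolFun_eq_comp 𝒰 t hf0]
  exact ((continuous_step h𝒰 t).comp (continuous_id.prodMk hf)).comp (by fun_prop)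

theorem tendsto_evolFun {𝒰 : EvolutionFamily X} (h𝒰 : 𝒰.ExponentiallyBounded) (t : ℝ≥0)
    {f : ℝ≥0 → X} (hf : Tendsto f (cocompact ℝ≥0) (𝓝 0)) (hf0 : f 0 = 0) :
    Tendsto (evolFun 𝒰 t f) (cocompact ℝ≥0) (𝓝 0) := by
  obtain ⟨C, hC⟩ := exists_bound h𝒰 t
  rw [evolFun_eq_comp 𝒰 t hf0]
  have hg : Tendsto (fun σ => 𝒰.U (σ + t) σ (f σ)) (cocompact ℝ≥0) (𝓝 0) := by
    refine squeeze_zero_norm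
      (fun σ => ContinuousLinearMap.le_of_opNorm_le _ (hC σ) _) ?_
    simpa using hf.norm.const_mul (C : ℝ)
  have hc : cocompact ℝ≥0 = atTop := by
    refine le_antisymm ?_ ?_
    · refine (atTop_basis.ge_iff).2 fun b _ => ?_
      refine mem_cocompact.2 ⟨Set.Icc 0 b, isCompact_Icc, fun x hx => ?_⟩
      by_contra h
      exact hx ⟨zero_le, (not_le.1 h).le⟩
    · exact atTop_le_cocompact
  rw [hc] at hg ⊢
  refine hg.comp (tendsto_atTop.2 fun b => ?_)
  filter_upwards [eventually_ge_atTop (b + t)] with τ hτ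
  exact le_tsub_of_add_le_right hτ

theorem norm_evolFun_le {𝒰 : EvolutionFamily X} {t C : ℝ≥0}
    (hC : ∀ σ : ℝ≥0, ‖𝒰.U (σ + t) σ‖ ≤ C) {f : ℝ≥0 → X} {B : ℝ} (hB : ∀ σ, ‖f σ‖ ≤ B)
    (τ : ℝ≥0) : ‖evolFun 𝒰 t f τ‖ ≤ C * B := by
  have hB0 : 0 ≤ B := (norm_nonneg _).trans (hB 0)
  by_cases h : t ≤ τ
  · have := hC (τ - t)
    rw [tsub_add_cancel_of_le h] at this
    simp only [evolFun, h, if_true]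
    exact (ContinuousLinearMap.le_of_opNorm_le _ this _).trans (by gcongr; exact hB _)
  · simp only [evolFun, h, if_false, norm_zero]
    positivity

/-- The operator `E^t` on `C₀₀(ℝ₊, X)`. -/
def evolC00 (𝒰 : EvolutionFamily X) (h𝒰 : 𝒰.ExponentiallyBounded) (t : ℝ≥0) :
    C00 X →L[ℂ] C00 X :=
  LinearMap.mkContinuous
    { toFun := fun f =>
        ⟨⟨⟨evolFun 𝒰 t f, continuous_evolFun h𝒰 t (map_continuous (f : C₀(ℝ≥0, X))) f.2⟩,
          tendsto_evolFun h𝒰 t (zero_at_infty (f : C₀(ℝ≥0, X))) f.2⟩, by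
          change evolFun 𝒰 t f 0 = 0
          have hf : (f : C₀(ℝ≥0, X)) 0 = 0 := f.2
          simp [evolFun, hf]⟩
      map_add' := fun f g => Subtype.ext (DFunLike.coe_injective (evolFun_add 𝒰 t f g))
      map_smul' := fun c f => Subtype.ext (DFunLike.coe_injective (evolFun_smul 𝒰 t c f)) }
    (Classical.choose (exists_bound h𝒰 t) : ℝ≥0)
    (fun f => by
      have hC := Classical.choose_spec (exists_bound h𝒰 t)
      change ‖ZeroAtInftyContinuousMap.toBCF (⟨⟨evolFun 𝒰 t f, _⟩, _⟩ : C₀(ℝ≥0, X))‖ ≤ _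
      rw [BoundedContinuousFunction.norm_le (by positivity)]
      exact norm_evolFun_le hC
        (fun σ => BoundedContinuousFunction.norm_coe_le_norm (f : C₀(ℝ≥0, X)).toBCF σ))

theorem evolC00_apply (𝒰 : EvolutionFamily X) (h𝒰 : 𝒰.ExponentiallyBounded) (t : ℝ≥0)
    (f : C00 X) (τ : ℝ≥0) :
    (evolC00 𝒰 h𝒰 t f : C₀(ℝ≥0, X)) τ =
      if t ≤ τ then 𝒰.U τ (τ - t) ((f : C₀(ℝ≥0, X)) (τ - t)) else 0 := rfl

/-! ### The evolution semigroup on `L^p(ℝ₊, X)` -/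

/-- Lebesgue measure on the half-line `ℝ₊ = [0, ∞)`. -/
def halfLineMeasure : Measure ℝ≥0 := Measure.comap ((↑) : ℝ≥0 → ℝ) volume

theorem measurableEmbedding_coe : MeasurableEmbedding ((↑) : ℝ≥0 → ℝ) :=
  MeasurableEmbedding.subtype_coe measurableSet_Ici

theorem measurePreserving_sub (t : ℝ≥0) :
    MeasurePreserving (fun τ : ℝ≥0 => τ - t) (halfLineMeasure.restrict (Set.Ici t))
      halfLineMeasure := by
  refine ⟨by fun_prop, ?_⟩
  ext s hs
  have hm : Measurable fun τ : ℝ≥0 => τ - t := by fun_prop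
  rw [Measure.map_apply hm hs, Measure.restrict_apply (hm hs), halfLineMeasure,
    measurableEmbedding_coe.comap_apply, measurableEmbedding_coe.comap_apply]
  have : ((↑) : ℝ≥0 → ℝ) '' ((fun τ : ℝ≥0 => τ - t) ⁻¹' s ∩ Set.Ici t)
      = (fun x : ℝ => (t : ℝ) + x) '' (((↑) : ℝ≥0 → ℝ) '' s) := by
    ext x
    constructor
    · rintro ⟨τ, ⟨h1, h2⟩, rfl⟩
      refine ⟨_, ⟨τ - t, h1, rfl⟩, ?_⟩
      change (t : ℝ) + ((τ - t : ℝ≥0) : ℝ) = τ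
      rw [← NNReal.coe_add, add_tsub_cancel_of_le h2]
    · rintro ⟨_, ⟨σ, hσ, rfl⟩, rfl⟩
      exact ⟨t + σ, ⟨by simpa using hσ, by simp⟩, by simp⟩
  rw [this, Set.image_add_left, measure_preimage_add]

theorem evolFun_congr_ae (𝒰 : EvolutionFamily X) (t : ℝ≥0) {f g : ℝ≥0 → X}
    (h : f =ᵐ[halfLineMeasure] g) :
    evolFun 𝒰 t f =ᵐ[halfLineMeasure] evolFun 𝒰 t g := by
  rw [evolFun_eq_indicator, evolFun_eq_indicator]
  have h1 : (fun τ : ℝ≥0 => f (τ - t)) =ᵐ[halfLineMeasure.restrict (Set.Ici t)]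
      fun τ : ℝ≥0 => g (τ - t) :=
    (measurePreserving_sub t).quasiMeasurePreserving.ae_eq_comp h
  rw [Filter.EventuallyEq, ae_restrict_iff' measurableSet_Ici] at h1
  filter_upwards [h1] with τ hτ
  by_cases hm : τ ∈ Set.Ici t
  · simp [hm, hτ hm]
  · simp [hm]

theorem memLp_evolFun {𝒰 : EvolutionFamily X} (h𝒰 : 𝒰.ExponentiallyBounded) (t : ℝ≥0) {p : ℝ≥0∞}
    {f : ℝ≥0 → X} (hf : MemLp f p halfLineMeasure) :
    MemLp (evolFun 𝒰 t f) p halfLineMeasure := by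
  obtain ⟨C, hC⟩ := exists_bound h𝒰 t
  rw [evolFun_eq_indicator, memLp_indicator_iff_restrict measurableSet_Ici]
  refine MemLp.comp_measurePreserving ?_ (measurePreserving_sub t)
  exact hf.of_le_mul
    ((continuous_step h𝒰 t).comp_aestronglyMeasurable
      (aestronglyMeasurable_id.prodMk hf.aestronglyMeasurable))
    (Eventually.of_forall fun σ => ContinuousLinearMap.le_of_opNorm_le _ (hC σ) _)

theorem eLpNorm_evolFun_le {𝒰 : EvolutionFamily X} (h𝒰 : 𝒰.ExponentiallyBounded) {t C : ℝ≥0}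
    (hC : ∀ σ : ℝ≥0, ‖𝒰.U (σ + t) σ‖ ≤ C) {p : ℝ≥0∞}
    {f : ℝ≥0 → X} (hf : MemLp f p halfLineMeasure) :
    eLpNorm (evolFun 𝒰 t f) p halfLineMeasure ≤ C * eLpNorm f p halfLineMeasure := by
  rw [evolFun_eq_indicator, eLpNorm_indicator_eq_eLpNorm_restrict measurableSet_Ici,
    eLpNorm_comp_measurePreserving (g := fun σ => 𝒰.U (σ + t) σ (f σ))
      ((continuous_step h𝒰 t).comp_aestronglyMeasurable
        (aestronglyMeasurable_id.prodMk hf.aestronglyMeasurable)) (measurePreserving_sub t)]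
  refine (eLpNorm_le_nnreal_smul_eLpNorm_of_ae_le_mul (f := fun σ => 𝒰.U (σ + t) σ (f σ)) (g := f)
    (c := C) (Eventually.of_forall fun σ => ?_)
    p).trans (le_of_eq ?_)
  · exact ContinuousLinearMap.le_of_opNorm_le _ (hC σ) _
  · rfl

/-- The operator `E^t` on `L^p(ℝ₊, X)`. -/
def evolLp (𝒰 : EvolutionFamily X) (h𝒰 : 𝒰.ExponentiallyBounded) (p : ℝ≥0∞) [Fact (1 ≤ p)]
    (t : ℝ≥0) : Lp X p halfLineMeasure →L[ℂ] Lp X p halfLineMeasure :=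
  LinearMap.mkContinuous
    { toFun := fun f => (memLp_evolFun h𝒰 t (Lp.memLp f)).toLp (evolFun 𝒰 t f)
      map_add' := fun f g => by
        rw [← MemLp.toLp_add]
        refine MemLp.toLp_congr _ _ ?_
        rw [← evolFun_add]
        exact evolFun_congr_ae 𝒰 t (Lp.coeFn_add f g)
      map_smul' := fun c f => by
        rw [RingHom.id_apply, ← MemLp.toLp_const_smul]
        refine MemLp.toLp_congr _ _ ?_
        rw [← evolFun_smul]
        exact evolFun_congr_ae 𝒰 t (Lp.coeFn_smul c f) }
    (Classical.choose (exists_bound h𝒰 t) : ℝ≥0)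
    (fun f => by
      have hC := Classical.choose_spec (exists_bound h𝒰 t)
      change ‖(memLp_evolFun h𝒰 t (Lp.memLp f)).toLp (evolFun 𝒰 t f)‖ ≤ _
      rw [Lp.norm_toLp, Lp.norm_def, ← ENNReal.coe_toReal, ← ENNReal.toReal_mul]
      exact ENNReal.toReal_mono (ENNReal.mul_ne_top ENNReal.coe_ne_top (Lp.eLpNorm_ne_top f))
        (eLpNorm_evolFun_le h𝒰 hC (Lp.memLp f)))

theorem evolLp_coeFn (𝒰 : EvolutionFamily X) (h𝒰 : 𝒰.ExponentiallyBounded) (p : ℝ≥0∞)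
    [Fact (1 ≤ p)] (t : ℝ≥0) (f : Lp X p halfLineMeasure) :
    ∀ᵐ τ ∂halfLineMeasure, evolLp 𝒰 h𝒰 p t f τ =
      if t ≤ τ then 𝒰.U τ (τ - t) (f (τ - t)) else 0 :=
  MemLp.coeFn_toLp (memLp_evolFun h𝒰 t (Lp.memLp f))

end EvolutionSemigroup

end

/-! Everything reduces to one equivalence, for any fixed `t > 0`: a number `z` is in the resolvent
set of `Γ` iff `1 - e^{-zt} E^t` is invertible (`IsEvolution.mem_resolventSet_iff`). Rescaling
`U(t,τ)` by `e^{-z(t-τ)}` moves `z` to `0`.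

One direction holds for every strongly continuous semigroup: `∫₀ᵗ T(s) ds · (1 - T(t))⁻¹` inverts
`-Γ` (`zero_mem_resolventSet_of_isUnit`).

The other direction uses the evolution structure. On functions `φ(τ) U(τ,s) x` the generator acts as
`-d/dτ` on `φ` alone, and it is causal: if `Γ w` vanishes on `[0, t)`, so does `w`. For a bump `f₁`
on the orbit just after `s`, these two facts force `-Γ⁻¹ f₁` to equal the orbit on `[t-1, t)`. Hence
`‖U(t,s)‖` is bounded uniformly in `s ≤ t` (`exists_bound_of_zero_mem_resolventSet`). The resolvent
set is open, so the same bound for the family rescaled at some `-ν < 0` is exponential decay. Decay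
makes `1 - e^{-wt} E^t` invertible on a half-plane `Re w > -ν`.

Thus each resolvent point carries an open right half-plane of resolvent points containing it, which
makes the spectrum a closed left half-plane. Exponentiating gives the punctured disk, and `0` is in
the spectrum because functions in the range of `E^t` vanish on `[0, t)`. The spaces `C₀₀` and `L^p`
are treated together through the axioms `IsFunctionSpace` and `IsEvolution`. -/

noncomputable section

namespace EvolutionSemigroup

/-! ### Strongly continuous semigroups -/

section Semigroup

variable {F : Type*} [NormedAddCommGroup F] [NormedSpace ℂ F]

/-- An exponentially bounded, strongly continuous one-parameter semigroup of operators. -/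
structure IsC0Semigroup (T : ℝ≥0 → F →L[ℂ] F) : Prop where
  zero : T 0 = 1
  add : ∀ s t, T (s + t) = T s * T t
  cont : ∀ x, Continuous fun t => T t x
  bound : ∃ M ω : ℝ, 0 ≤ M ∧ ∀ t : ℝ≥0, ‖T t‖ ≤ M * Real.exp (ω * t)

/-- `x` lies in the domain of the generator, which maps it to `y`. -/
def HasGenerator (T : ℝ≥0 → F →L[ℂ] F) (x y : F) : Prop :=
  Tendsto (diffQuot T x) (𝓝[>] 0) (𝓝 y)

theorem HasGenerator.mem {T : ℝ≥0 → F →L[ℂ] F} {x y : F} (h : HasGenerator T x y) :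
    x ∈ (generator T).domain := ⟨y, h⟩

theorem HasGenerator.generator_eq {T : ℝ≥0 → F →L[ℂ] F} {x y : F} (h : HasGenerator T x y) :
    generator T ⟨x, h.mem⟩ = y :=
  tendsto_nhds_unique (tendsto_generator T ⟨x, h.mem⟩) h

theorem HasGenerator.sub {T : ℝ≥0 → F →L[ℂ] F} {x y x' y' : F} (h : HasGenerator T x y)
    (h' : HasGenerator T x' y') : HasGenerator T (x - x') (y - y') := by
  have := Tendsto.sub h h'
  refine this.congr fun t => ?_
  simp only [diffQuot, map_sub]
  rw [← smul_sub]
  congr 1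
  abel

/-- Trading the partial map `generator` for the relation `HasGenerator` removes domain proofs from
all later resolvent arguments. -/
theorem mem_operatorResolventSet_iff {T : ℝ≥0 → F →L[ℂ] F} {z : ℂ} :
    z ∈ operatorResolventSet (generator T) ↔ ∃ R : F →L[ℂ] F,
      (∀ y, HasGenerator T (R y) (z • R y - y)) ∧
      (∀ x y, HasGenerator T x y → R (z • x - y) = x) := by
  constructor
  · rintro ⟨R, h1, h2⟩
    refine ⟨R, fun y => ?_, fun x y h => ?_⟩
    · obtain ⟨h, e⟩ := h1 y
      have := tendsto_generator T ⟨R y, h⟩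
      rwa [show generator T ⟨R y, h⟩ = z • R y - y from
        (sub_eq_iff_eq_add.1 e).symm ▸ by abel] at this
    · have := h2 ⟨x, h.mem⟩
      rwa [h.generator_eq] at this
  · rintro ⟨R, h1, h2⟩
    refine ⟨R, fun y => ⟨(h1 y).mem, ?_⟩, fun x => h2 _ _ (tendsto_generator T x)⟩
    rw [(h1 y).generator_eq]
    abel

/-! ### Rescaling and shifts of the resolvent set. -/

/-- The rescaled semigroup `e^{-λt} T(t)`. -/
def rescale (T : ℝ≥0 → F →L[ℂ] F) (z : ℂ) (t : ℝ≥0) : F →L[ℂ] F :=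
  Complex.exp (-z * ((t : ℝ) : ℂ)) • T t

theorem rescale_rescale (T : ℝ≥0 → F →L[ℂ] F) (z w : ℂ) :
    rescale (rescale T z) w = rescale T (z + w) := by
  funext t
  rw [rescale, rescale, rescale, smul_smul, ← Complex.exp_add]
  congr 2
  ring

theorem rescale_zero (T : ℝ≥0 → F →L[ℂ] F) : rescale T 0 = T := by
  funext t
  simp [rescale]

theorem norm_rescale (T : ℝ≥0 → F →L[ℂ] F) (z : ℂ) (t : ℝ≥0) :
    ‖rescale T z t‖ = Real.exp (-z.re * t) * ‖T t‖ := by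
  rw [rescale, norm_smul, Complex.norm_exp]
  simp

theorem IsC0Semigroup.rescaled {T : ℝ≥0 → F →L[ℂ] F} (hT : IsC0Semigroup T) (z : ℂ) :
    IsC0Semigroup (rescale T z) where
  zero := by simp [rescale, hT.zero]
  add s t := by
    rw [rescale, rescale, rescale,
      hT.add, smul_mul_smul_comm, ← Complex.exp_add]
    congr 2
    push_cast
    ring
  cont x := by
    have := hT.cont x
    simp only [rescale, FunLike.coe_smul, Pi.smul_apply]
    fun_prop
  bound := by
    obtain ⟨M, ω, hM, h⟩ := hT.bound
    refine ⟨M, ω - z.re, hM, fun t => ?_⟩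
    rw [norm_rescale]
    calc _ ≤ Real.exp (-z.re * t) * (M * Real.exp (ω * t)) := by gcongr; exact h t
      _ = _ := by
        rw [mul_left_comm, ← Real.exp_add]
        ring_nf

theorem tendsto_coe_nhdsGT :
    Tendsto ((↑) : ℝ≥0 → ℝ) (𝓝[>] 0) (𝓝[≠] 0) := by
  refine tendsto_nhdsWithin_iff.2 ⟨?_, ?_⟩
  · exact (NNReal.continuous_coe.tendsto' 0 0 rfl).mono_left nhdsWithin_le_nhds
  · filter_upwards [self_mem_nhdsWithin] with t ht
    exact (NNReal.coe_pos.2 ht).ne'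

/-- Product rule at `t = 0`, from `e^{-zt} T(t) x - x = e^{-zt} (T(t) x - x) + (e^{-zt} - 1) x`. -/
theorem HasGenerator.rescaled {T : ℝ≥0 → F →L[ℂ] F} {x y : F} (h : HasGenerator T x y) (z : ℂ) :
    HasGenerator (rescale T z) x (y - z • x) := by
  have hd : HasDerivAt (fun t : ℝ => Complex.exp (-z * (t : ℂ))) (-z) 0 := by
    have := ((Complex.ofRealCLM.hasDerivAt (x := (0 : ℝ))).const_mul (-z)).cexp
    simpa using this
  have h1 := (hd.tendsto_slope_zero.comp tendsto_coe_nhdsGT).smul_const x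
  have h2 : Tendsto (fun t : ℝ≥0 => Complex.exp (-z * ((t : ℝ) : ℂ))) (𝓝[>] 0) (𝓝 1) := by
    have : Continuous fun t : ℝ≥0 => Complex.exp (-z * ((t : ℝ) : ℂ)) := by fun_prop
    exact (this.tendsto' 0 1 (by simp)).mono_left nhdsWithin_le_nhds
  have h3 := (h2.smul h).add h1
  rw [one_smul, neg_smul, ← sub_eq_add_neg] at h3
  refine h3.congr fun t => ?_
  simp only [Function.comp, diffQuot, rescale, FunLike.coe_smul, Pi.smul_apply,
    zero_add, Complex.ofReal_zero, mul_zero, Complex.exp_zero, smul_sub, Complex.real_smul,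
    Complex.ofReal_inv, smul_smul, sub_smul, mul_one]
  rw [mul_comm (Complex.exp _)]
  abel

theorem mem_operatorResolventSet_rescale {T : ℝ≥0 → F →L[ℂ] F} {z w : ℂ}
    (h : z + w ∈ operatorResolventSet (generator T)) :
    w ∈ operatorResolventSet (generator (rescale T z)) := by
  rw [mem_operatorResolventSet_iff] at h ⊢
  obtain ⟨R, h1, h2⟩ := h
  refine ⟨R, fun y => ?_, fun x y h => ?_⟩
  · convert (h1 y).rescaled z using 1
    rw [add_smul]
    abel
  · have := h.rescaled (-z)
    rw [rescale_rescale, add_neg_cancel, rescale_zero] at this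
    convert h2 _ _ this using 2
    rw [add_smul, neg_smul]
    abel

theorem mem_operatorResolventSet_rescale_iff {T : ℝ≥0 → F →L[ℂ] F} {z w : ℂ} :
    w ∈ operatorResolventSet (generator (rescale T z)) ↔
      z + w ∈ operatorResolventSet (generator T) := by
  refine ⟨fun h => ?_, mem_operatorResolventSet_rescale⟩
  have := mem_operatorResolventSet_rescale (T := rescale T z) (z := -z) (w := z + w) (by simpa)
  rwa [rescale_rescale, add_neg_cancel, rescale_zero] at this

/-! ### Orbit integrals and the resolvent of the generator. -/

section Integral

variable {T : ℝ≥0 → F →L[ℂ] F}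

theorem IsC0Semigroup.continuous_orbit (hT : IsC0Semigroup T) (x : F) :
    Continuous fun s : ℝ => T s.toNNReal x := (hT.cont x).comp continuous_real_toNNReal

theorem IsC0Semigroup.intervalIntegrable (hT : IsC0Semigroup T) (x : F) (a b : ℝ) :
    IntervalIntegrable (fun s : ℝ => T s.toNNReal x) volume a b :=
  (hT.continuous_orbit x).intervalIntegrable a b

theorem IsC0Semigroup.exists_bound_Icc (hT : IsC0Semigroup T) (b : ℝ) :
    ∃ C : ℝ, 0 ≤ C ∧ ∀ t : ℝ≥0, t ≤ b → ‖T t‖ ≤ C := by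
  obtain ⟨M, ω, hM, h⟩ := hT.bound
  refine ⟨M * Real.exp (|ω| * |b|), by positivity, fun t ht => (h t).trans ?_⟩
  gcongr
  · exact le_abs_self ω
  · exact ht.trans (le_abs_self b)

/-- The operator `x ↦ ∫₀ᵗ T(s) x ds`. -/
def orbitIntegral (hT : IsC0Semigroup T) (t : ℝ≥0) : F →L[ℂ] F :=
  LinearMap.mkContinuous
    { toFun := fun x => ∫ s in (0 : ℝ)..t, T s.toNNReal x
      map_add' := fun x y => by
        simp only [map_add]
        exact intervalIntegral.integral_add (hT.intervalIntegrable x 0 t)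
          (hT.intervalIntegrable y 0 t)
      map_smul' := fun c x => by
        simp only [map_smul, RingHom.id_apply]
        exact intervalIntegral.integral_smul c _ }
    (Classical.choose (hT.exists_bound_Icc t) * |(t : ℝ) - 0|) (fun x => by
      have hC := Classical.choose_spec (hT.exists_bound_Icc t)
      change ‖∫ s in (0 : ℝ)..t, T s.toNNReal x‖ ≤ _
      rw [mul_right_comm]
      refine intervalIntegral.norm_integral_le_of_norm_le_const fun s hs => ?_
      rw [Set.uIoc_of_le t.coe_nonneg] at hs
      exact ContinuousLinearMap.le_of_opNorm_le _
        (hC.2 _ (by rw [Real.coe_toNNReal _ hs.1.le]; exact hs.2)) _)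

theorem orbitIntegral_apply (hT : IsC0Semigroup T) (t : ℝ≥0) (x : F) :
    orbitIntegral hT t x = ∫ s in (0 : ℝ)..t, T s.toNNReal x := rfl

theorem IsC0Semigroup.pow (hT : IsC0Semigroup T) (t : ℝ≥0) (n : ℕ) : T t ^ n = T (n * t) := by
  induction n with
  | zero => simp [hT.zero]
  | succ n ih => rw [pow_succ, ih, ← hT.add]; congr 1; push_cast; ring

variable [CompleteSpace F]

theorem apply_orbitIntegral (hT : IsC0Semigroup T) (h t : ℝ≥0) (x : F) :
    T h (orbitIntegral hT t x) = orbitIntegral hT t (T h x) := by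
  rw [orbitIntegral_apply, orbitIntegral_apply,
    ← ContinuousLinearMap.intervalIntegral_comp_comm (T h) (hT.intervalIntegrable x 0 t)]
  congr 1
  funext s
  change (T h * T s.toNNReal) x = (T s.toNNReal * T h) x
  rw [← hT.add, ← hT.add, add_comm]

/-- Since `T(h) ∫₀ᵗ T(s) x ds = ∫ₕ^{t+h} T(s) x ds`, the difference quotient is the slope of `u ↦
∫₀ᵘ T(s) x ds` at `t` minus its slope at `0`. -/
theorem hasGenerator_orbitIntegral (hT : IsC0Semigroup T) (t : ℝ≥0) (x : F) :
    HasGenerator T (orbitIntegral hT t x) (T t x - x) := by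
  have hc := hT.continuous_orbit x
  have hd : ∀ u : ℝ, HasDerivAt (fun u : ℝ => ∫ s in (0 : ℝ)..u, T s.toNNReal x)
      (T u.toNNReal x) u := fun u =>
    intervalIntegral.integral_hasDerivAt_right (hT.intervalIntegrable x 0 u)
      (hc.stronglyMeasurableAtFilter _ _) hc.continuousAt
  have h1 := ((hd t).tendsto_slope_zero.sub (hd 0).tendsto_slope_zero).comp tendsto_coe_nhdsGT
  rw [Real.toNNReal_coe, Real.toNNReal_zero, hT.zero, one_apply_eq_self] at h1
  refine h1.congr fun h => ?_
  have e : T h (orbitIntegral hT t x) = ∫ s in (h : ℝ)..(t + h), T s.toNNReal x := by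
    rw [orbitIntegral_apply,
      ← ContinuousLinearMap.intervalIntegral_comp_comm (T h) (hT.intervalIntegrable x 0 t)]
    have := intervalIntegral.integral_comp_add_right (a := 0) (b := (t : ℝ))
      (fun s => T s.toNNReal x) (h : ℝ)
    rw [zero_add] at this
    rw [← this]
    refine intervalIntegral.integral_congr fun s hs => ?_
    rw [Set.uIcc_of_le t.coe_nonneg] at hs
    change T h (T s.toNNReal x) = T (s + h).toNNReal x
    rw [Real.toNNReal_add hs.1 h.coe_nonneg, Real.toNNReal_coe, add_comm, hT.add]
    rfl
  have e2 : ∫ s in (h : ℝ)..(t + h), T s.toNNReal x =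
      (∫ s in (0 : ℝ)..(t + h), T s.toNNReal x) - ∫ s in (0 : ℝ)..h, T s.toNNReal x :=
    (intervalIntegral.integral_interval_sub_left (hT.intervalIntegrable x _ _)
      (hT.intervalIntegrable x _ _)).symm
  simp only [Function.comp, diffQuot, e, e2, zero_add,
    intervalIntegral.integral_same, sub_zero]
  rw [orbitIntegral_apply, ← smul_sub, ← Complex.ofReal_inv, Complex.coe_smul]
  congr 1
  abel

/-- The orbit integral is bounded and commutes with difference quotients, so it passes through the
limit defining `Γ x`. -/
theorem orbitIntegral_generator (hT : IsC0Semigroup T) (t : ℝ≥0) {x y : F}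
    (h : HasGenerator T x y) : orbitIntegral hT t y = T t x - x := by
  refine tendsto_nhds_unique (((orbitIntegral hT t).continuous.tendsto y).comp h) ?_
  refine (hasGenerator_orbitIntegral hT t x).congr fun s => ?_
  simp only [Function.comp, diffQuot, map_smul, map_sub, apply_orbitIntegral]

/-- The two preceding lemmas say that `Γ` composed with the orbit integral is `T(t) - 1` in either
order. Dividing by `1 - T(t)`, which commutes with the integral, gives a two-sided inverse of `-Γ`.
-/
theorem zero_mem_resolventSet_of_isUnit (hT : IsC0Semigroup T) {t : ℝ≥0}
    (h : IsUnit (1 - T t)) : (0 : ℂ) ∈ operatorResolventSet (generator T) := by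
  obtain ⟨u, hu⟩ := h
  have hcomm : Commute (orbitIntegral hT t) (1 - T t) := by
    refine ContinuousLinearMap.ext fun x => ?_
    change orbitIntegral hT t (x - T t x) = orbitIntegral hT t x - T t (orbitIntegral hT t x)
    rw [map_sub, apply_orbitIntegral]
  rw [← hu] at hcomm
  have hinv := hcomm.units_inv_right
  have e1 : ∀ y, ((u⁻¹ : (F →L[ℂ] F)ˣ) : F →L[ℂ] F) y
      - T t (((u⁻¹ : (F →L[ℂ] F)ˣ) : F →L[ℂ] F) y) = y := fun y => by
    have := congrArg (fun f : F →L[ℂ] F => f y) u.mul_inv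
    rwa [hu] at this
  have e2 : ∀ y, ((u⁻¹ : (F →L[ℂ] F)ˣ) : F →L[ℂ] F) (y - T t y) = y := fun y => by
    have := congrArg (fun f : F →L[ℂ] F => f y) u.inv_mul
    rwa [hu] at this
  rw [mem_operatorResolventSet_iff]
  refine ⟨orbitIntegral hT t * ((u⁻¹ : (F →L[ℂ] F)ˣ) : F →L[ℂ] F), fun y => ?_, fun x y h => ?_⟩
  · have := hasGenerator_orbitIntegral hT t (((u⁻¹ : (F →L[ℂ] F)ˣ) : F →L[ℂ] F) y)
    rw [← neg_sub, e1] at this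
    simpa using this
  · rw [hinv.eq, zero_smul, zero_sub, mul_apply_eq_comp, map_neg,
      orbitIntegral_generator hT t h, neg_sub, e2]

theorem mem_resolventSet_of_isUnit (hT : IsC0Semigroup T) {t : ℝ≥0} {z : ℂ}
    (h : IsUnit (1 - rescale T z t)) : z ∈ operatorResolventSet (generator T) := by
  have := zero_mem_resolventSet_of_isUnit (hT.rescaled z) h
  rwa [mem_operatorResolventSet_rescale_iff, add_zero] at this

/-- Decay gives `‖T(t)ⁿ‖ < 1` for some `n`, so `1 - T(t)ⁿ` is invertible. Its factor `1 - T(t)`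
commutes with the geometric sum, hence is invertible as well. -/
theorem isUnit_one_sub_of_decay (hT : IsC0Semigroup T) {N ν : ℝ} (hν : 0 < ν)
    (h : ∀ t : ℝ≥0, ‖T t‖ ≤ N * Real.exp (-ν * t)) {t : ℝ≥0} (ht : 0 < t) :
    IsUnit (1 - T t) := by
  have hlim : Tendsto (fun n : ℕ => N * Real.exp (-ν * ((n : ℝ≥0) * t : ℝ≥0))) atTop (𝓝 0) := by
    rw [← mul_zero N]
    refine (Real.tendsto_exp_atBot.comp ?_).const_mul N
    have ht' : (0 : ℝ) < t := ht
    have := (tendsto_natCast_atTop_atTop (R := ℝ)).const_mul_atTop_of_neg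
      (show -ν * (t : ℝ) < 0 by nlinarith)
    refine this.congr fun n => ?_
    push_cast
    ring
  obtain ⟨n, hn⟩ := (hlim.eventually_lt_const one_pos).exists
  have hu : IsUnit (1 - T t ^ n) := by
    rw [hT.pow]
    exact isUnit_one_sub_of_norm_lt_one ((h _).trans_lt hn)
  have hc : Commute (1 - T t) (∑ i ∈ Finset.range n, T t ^ i) :=
    Commute.sum_right _ _ _ fun i _ =>
      (Commute.one_left _).sub_left ((Commute.refl (T t)).pow_right i)
  rw [← mul_neg_geom_sum] at hu
  exact (hc.isUnit_mul_iff.1 hu).1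

/-- Neumann series: with `R = -Γ⁻¹`, the resolvent at `-ν` is `R (1 - νR)⁻¹` as soon as `ν‖R‖ < 1`.
-/
theorem neg_mem_resolventSet (h : (0 : ℂ) ∈ operatorResolventSet (generator T)) :
    ∃ ν : ℝ, 0 < ν ∧ ((-ν : ℝ) : ℂ) ∈ operatorResolventSet (generator T) := by
  rw [mem_operatorResolventSet_iff] at h
  obtain ⟨R, h1, h2⟩ := h
  simp only [zero_smul, zero_sub] at h1 h2
  set ν : ℝ := (‖R‖ + 1)⁻¹ with hν
  have hν0 : 0 < ν := by positivity
  have hn : ‖(ν : ℂ) • R‖ < 1 := by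
    rw [norm_smul, Complex.norm_real, Real.norm_of_nonneg hν0.le, hν,
      inv_mul_lt_iff₀ (by positivity)]
    linarith
  obtain ⟨u, hu⟩ := isUnit_one_sub_of_norm_lt_one hn
  set S : F →L[ℂ] F := ((u⁻¹ : (F →L[ℂ] F)ˣ) : F →L[ℂ] F) with hS
  have e1 : ∀ y, S y - (ν : ℂ) • R (S y) = y := fun y => by
    have := congrArg (fun f : F →L[ℂ] F => f y) u.mul_inv
    rwa [hu] at this
  have e2 : ∀ y, S (y - (ν : ℂ) • R y) = y := fun y => by
    have := congrArg (fun f : F →L[ℂ] F => f y) u.inv_mul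
    rwa [hu] at this
  refine ⟨ν, hν0, mem_operatorResolventSet_iff.2 ⟨R * S, fun y => ?_, fun x y h => ?_⟩⟩
  · have e : ((-ν : ℝ) : ℂ) • (R * S) y - y = -S y := by
      rw [Complex.ofReal_neg, neg_smul, mul_apply_eq_comp]
      rw [← sub_eq_zero, ← sub_eq_zero.2 (e1 y)]
      abel
    rw [e]
    exact h1 (S y)
  · have hx : x = R (-y) := (h2 x y h).symm
    have : (((-ν : ℝ) : ℂ) • x - y) = (-y) - (ν : ℂ) • R (-y) := by
      rw [← hx, Complex.ofReal_neg, neg_smul]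
      abel
    rw [this, mul_apply_eq_comp, e2, ← hx]

end Integral

end Semigroup

/-! ### Function spaces on the half-line and evolution semigroups on them -/

section Model

variable {F : Type*} [NormedAddCommGroup F] [NormedSpace ℂ F]
variable {X : Type*} [NormedAddCommGroup X] [NormedSpace ℂ X]

/-- `F` is a normed space of (classes of) functions `ℝ₊ → X`. The map `ev` chooses representatives,
and functions that agree eventually along `l` are identified. The axioms are the common features of
`C₀₀(ℝ₊, X)` (with `l = ⊤`) and `L^p(ℝ₊, X)`, `p < ∞` (with `l` the almost everywhere filter). -/
structure IsFunctionSpace (l : Filter ℝ≥0) (ev : F → ℝ≥0 → X) : Prop where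
  ev_sub : ∀ f g, ev (f - g) =ᶠ[l] ev f - ev g
  ev_smul : ∀ (c : ℂ) f, ev (c • f) =ᶠ[l] c • ev f
  ext : ∀ f g, ev f =ᶠ[l] ev g → f = g
  exists_rep : ∀ (g : ℝ≥0 → X) (b : ℝ≥0), Continuous g → g 0 = 0 → (∀ τ, b ≤ τ → g τ = 0) →
    ∃ f, ev f =ᶠ[l] g
  -- The factor `1 + d` dominates both `1` (supremum norm) and `d^{1/p}` (`L^p` norm), so no
  -- exponent enters the axioms.
  norm_le : ∀ (f : F) (a d : ℝ≥0) (c : ℝ), 0 ≤ c → (∀ᶠ τ in l, ‖ev f τ‖ ≤ c) →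
    (∀ᶠ τ in l, τ < a → ev f τ = 0) → (∀ᶠ τ in l, a + d ≤ τ → ev f τ = 0) → ‖f‖ ≤ (1 + d) * c
  -- A window of length one has measure one, so the constant is `1` for every `p`.
  le_norm : ∀ (f : F) (a : ℝ≥0) (c : ℝ), (∀ᶠ τ in l, a ≤ τ → τ < a + 1 → c ≤ ‖ev f τ‖) → c ≤ ‖f‖
  isClosed_vanishing : ∀ a : ℝ≥0, IsClosed {f | ∀ᶠ τ in l, τ < a → ev f τ = 0}
  dense : Dense {f | ∃ (g : ℝ≥0 → X) (b : ℝ≥0), Continuous g ∧ g 0 = 0 ∧ (∀ τ, b ≤ τ → g τ = 0) ∧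
    ev f =ᶠ[l] g}

/-- `T t` acts on a function space by `f ↦ evolFun 𝒰 t f`. -/
structure IsEvolution (𝒰 : EvolutionFamily X) (l : Filter ℝ≥0) (ev : F → ℝ≥0 → X)
    (T : ℝ≥0 → F →L[ℂ] F) : Prop extends IsFunctionSpace l ev where
  ev_apply : ∀ t f, ev (T t f) =ᶠ[l] evolFun 𝒰 t (ev f)
  evolFun_congr : ∀ t (f g : ℝ≥0 → X), f =ᶠ[l] g → evolFun 𝒰 t f =ᶠ[l] evolFun 𝒰 t g
  norm_apply_le : ∀ t C : ℝ≥0, (∀ σ, ‖𝒰.U (σ + t) σ‖ ≤ C) → ‖T t‖ ≤ C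

/-- The rescaled evolution family `e^{-λ(t-τ)} U(t,τ)`. -/
def EvolutionFamily.rescale (𝒰 : EvolutionFamily X) (z : ℂ) : EvolutionFamily X where
  U t s := Complex.exp (-z * (((t : ℝ) : ℂ) - ((s : ℝ) : ℂ))) • 𝒰.U t s
  comp t s τ h1 h2 := by
    rw [𝒰.comp t s τ h1 h2, ContinuousLinearMap.smul_comp, ContinuousLinearMap.comp_smul, smul_smul,
      ← Complex.exp_add]
    congr 2
    ring
  refl t := by simp [𝒰.refl]
  continuousOn x := by
    have h := 𝒰.continuousOn x
    simp only [FunLike.coe_smul, Pi.smul_apply]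
    exact ContinuousOn.smul (by fun_prop) h

theorem EvolutionFamily.norm_rescale_le_iff (𝒰 : EvolutionFamily X) (z : ℂ) (t s : ℝ≥0) (C : ℝ) :
    ‖(𝒰.rescale z).U t s‖ ≤ C ↔ ‖𝒰.U t s‖ ≤ Real.exp (z.re * (t - s)) * C := by
  have : ‖(𝒰.rescale z).U t s‖ = Real.exp (-(z.re * (t - s))) * ‖𝒰.U t s‖ := by
    rw [EvolutionFamily.rescale, norm_smul, Complex.norm_exp]
    simp
  rw [this, Real.exp_neg, inv_mul_le_iff₀ (Real.exp_pos _)]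

theorem EvolutionFamily.ExponentiallyBounded.rescaled {𝒰 : EvolutionFamily X}
    (h : 𝒰.ExponentiallyBounded) (z : ℂ) : (𝒰.rescale z).ExponentiallyBounded := by
  obtain ⟨M, ω, hM, h⟩ := h
  refine ⟨M, ω - z.re, hM, fun t τ hτ => ?_⟩
  rw [EvolutionFamily.norm_rescale_le_iff, mul_left_comm, ← Real.exp_add]
  convert h t τ hτ using 3
  ring

theorem evolFun_rescale (𝒰 : EvolutionFamily X) (z : ℂ) (t : ℝ≥0) (f : ℝ≥0 → X) :
    evolFun (𝒰.rescale z) t f = Complex.exp (-z * ((t : ℝ) : ℂ)) • evolFun 𝒰 t f := by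
  funext τ
  by_cases h : t ≤ τ
  · simp [evolFun, h, EvolutionFamily.rescale, NNReal.coe_sub h]
  · simp [evolFun, h]

theorem evolFun_zero (𝒰 : EvolutionFamily X) (f : ℝ≥0 → X) : evolFun 𝒰 0 f = f := by
  funext τ
  simp [evolFun, 𝒰.refl]

theorem evolFun_evolFun (𝒰 : EvolutionFamily X) (s t : ℝ≥0) (f : ℝ≥0 → X) :
    evolFun 𝒰 s (evolFun 𝒰 t f) = evolFun 𝒰 (s + t) f := by
  funext τ
  by_cases h : s ≤ τ
  · have e : t ≤ τ - s ↔ s + t ≤ τ := by rw [le_tsub_iff_left h]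
    by_cases h' : t ≤ τ - s
    · simp only [evolFun, h, h', e.1 h', if_true]
      rw [tsub_tsub, 𝒰.comp τ (τ - s) (τ - (s + t)) (tsub_le_tsub_left le_self_add _) tsub_le_self]
      rfl
    · simp [evolFun, h, h', e.not.1 h']
  · have : ¬ s + t ≤ τ := fun h' => h (le_self_add.trans h')
    simp [evolFun, h, this]

variable {𝒰 : EvolutionFamily X} {l : Filter ℝ≥0} {ev : F → ℝ≥0 → X} {T : ℝ≥0 → F →L[ℂ] F}

theorem IsEvolution.rescaled (hT : IsEvolution 𝒰 l ev T) (z : ℂ) :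
    IsEvolution (𝒰.rescale z) l ev (rescale T z) where
  toIsFunctionSpace := hT.toIsFunctionSpace
  ev_apply t f := by
    rw [evolFun_rescale]
    exact (hT.ev_smul _ _).trans ((hT.ev_apply t f).const_smul _)
  evolFun_congr t f g h := by
    rw [evolFun_rescale, evolFun_rescale]
    exact (hT.evolFun_congr t f g h).const_smul _
  norm_apply_le t C h := by
    have := hT.norm_apply_le t ((Real.exp (z.re * t)).toNNReal * C) (fun σ => by
      have := (EvolutionFamily.norm_rescale_le_iff _ _ _ _ _).1 (h σ)
      simpa [Real.coe_toNNReal _ (Real.exp_pos _).le] using this)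
    rw [NNReal.coe_mul, Real.coe_toNNReal _ (Real.exp_pos _).le] at this
    rw [norm_rescale, neg_mul, Real.exp_neg, inv_mul_le_iff₀ (Real.exp_pos _)]
    exact this

theorem IsFunctionSpace.ev_zero (h : IsFunctionSpace l ev) : ev 0 =ᶠ[l] 0 := by
  simpa using h.ev_sub 0 0

/-- The functions that vanish on `[0, a)`. -/
def IsFunctionSpace.vanishing (h : IsFunctionSpace l ev) (a : ℝ≥0) : Submodule ℂ F where
  carrier := {f | ∀ᶠ τ in l, τ < a → ev f τ = 0}
  zero_mem' := h.ev_zero.mono fun τ hτ _ => hτ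
  add_mem' := by
    intro f g hf hg
    have e1 := h.ev_smul (-1) g
    have e2 := h.ev_sub f ((-1 : ℂ) • g)
    rw [neg_one_smul, sub_neg_eq_add] at e2
    rw [neg_one_smul] at e1
    filter_upwards [hf, hg, e1, e2] with τ h1 h2 h3 h4 hτ
    simp [h4, h3, h1 hτ, h2 hτ]
  smul_mem' := by
    intro c f hf
    filter_upwards [hf, h.ev_smul c f] with τ h1 h2 hτ
    simp [h2, h1 hτ]

theorem IsEvolution.apply_mem_vanishing_self (hT : IsEvolution 𝒰 l ev T) (a : ℝ≥0) (f : F) :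
    T a f ∈ hT.vanishing a := by
  refine (hT.ev_apply a f).mono fun τ h hτ => ?_
  rw [h]
  simp [evolFun, hτ]

theorem IsEvolution.apply_mem_vanishing (hT : IsEvolution 𝒰 l ev T) {a : ℝ≥0} {f : F}
    (hf : f ∈ hT.vanishing a) (t : ℝ≥0) : T t f ∈ hT.vanishing a := by
  -- A representative vanishing everywhere on `[0, a)` is needed: only `evolFun_congr` carries
  -- eventual equalities through the translation.
  have h1 : ev f =ᶠ[l] (Set.Ici a).indicator (ev f) := by
    refine hf.mono fun τ hτ => ?_
    by_cases h : a ≤ τ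
    · simp [h]
    · simp [h, hτ (not_le.1 h)]
  refine ((hT.ev_apply t f).trans (hT.evolFun_congr t _ _ h1)).mono fun τ h hτ => ?_
  have h2 : ¬ a ≤ τ - t := not_le.2 (tsub_le_self.trans_lt hτ)
  rw [h]
  simp [evolFun, h2]

/-! ### Strong continuity of evolution semigroups. -/

variable (hT : IsEvolution 𝒰 l ev T) (h𝒰 : 𝒰.ExponentiallyBounded)

include h𝒰 in
/-- Joint continuity of the evolution family applied to a translated function. -/
theorem continuous_evolution {g : ℝ≥0 → X} (hg : Continuous g) :
    Continuous fun q : ℝ≥0 × ℝ≥0 => 𝒰.U q.2 (q.2 - q.1) (g (q.2 - q.1)) := by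
  obtain ⟨M, ω, hM, hb⟩ := h𝒰
  have hs : ∀ x : X, Continuous fun q : ℝ≥0 × ℝ≥0 => 𝒰.U q.2 (q.2 - q.1) x := fun x =>
    (𝒰.continuousOn x).comp_continuous (f := fun q : ℝ≥0 × ℝ≥0 => (q.2, q.2 - q.1)) (by fun_prop)
      (fun q => show q.2 - q.1 ≤ q.2 from tsub_le_self)
  rw [continuous_iff_continuousAt]
  intro q₀
  have h1 : Tendsto (fun q : ℝ≥0 × ℝ≥0 => 𝒰.U q.2 (q.2 - q.1) (g (q.2 - q.1) - g (q₀.2 - q₀.1)))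
      (𝓝 q₀) (𝓝 0) := by
    refine squeeze_zero_norm (a := fun q : ℝ≥0 × ℝ≥0 =>
      M * Real.exp (ω * ((q.2 : ℝ) - (q.2 - q.1 : ℝ≥0))) * ‖g (q.2 - q.1) - g (q₀.2 - q₀.1)‖)
      (fun q => ContinuousLinearMap.le_of_opNorm_le _ (hb _ _ tsub_le_self) _) ?_
    refine Continuous.tendsto' (by fun_prop) _ _ (by simp)
  have h3 := h1.add ((hs (g (q₀.2 - q₀.1))).tendsto q₀)
  simp only [map_sub, sub_add_cancel, zero_add] at h3
  exact h3

/-- For `τ < t` the truncated difference `τ - t` is `0`, where `g` vanishes. The formula without a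
case split is jointly continuous in `t` and `τ`. -/
theorem evolFun_eq_of_zero (t : ℝ≥0) {g : ℝ≥0 → X} (hg : g 0 = 0) (τ : ℝ≥0) :
    evolFun 𝒰 t g τ = 𝒰.U τ (τ - t) (g (τ - t)) := by
  by_cases h : t ≤ τ
  · simp [evolFun, h]
  · simp [evolFun, h, tsub_eq_zero_of_le (not_le.1 h).le, hg]

include hT h𝒰 in
theorem tendsto_apply_of_continuous {f : F} {g : ℝ≥0 → X} {b : ℝ≥0} (hg : Continuous g)
    (hg0 : g 0 = 0) (hgb : ∀ τ, b ≤ τ → g τ = 0) (hf : ev f =ᶠ[l] g) :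
    Tendsto (fun t => T t f) (𝓝 0) (𝓝 f) := by
  rw [Metric.tendsto_nhds]
  intro ε hε
  set δ : ℝ := ε / (2 * (1 + (b + 1 : ℝ≥0))) with hδ
  have hδ0 : 0 < δ := by positivity
  have hW := continuous_evolution h𝒰 hg
  -- Joint continuity is uniform over the compact interval `[0, b + 1]`. Beyond it both functions
  -- vanish once `t ≤ 1`.
  have h1 : ∀ᶠ t in 𝓝 (0 : ℝ≥0), ∀ τ ∈ Set.Icc (0 : ℝ≥0) (b + 1),
      ‖𝒰.U τ (τ - t) (g (τ - t)) - g τ‖ < δ := by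
    refine isCompact_Icc.eventually_forall_of_forall_eventually fun τ _ => ?_
    have : Continuous fun q : ℝ≥0 × ℝ≥0 => ‖𝒰.U q.2 (q.2 - q.1) (g (q.2 - q.1)) - g q.2‖ := by
      fun_prop
    exact this.continuousAt.eventually_lt_const (by simpa [𝒰.refl] using hδ0)
  filter_upwards [h1, eventually_le_nhds (show (0 : ℝ≥0) < 1 by norm_num)] with t ht ht1
  have e : ev (T t f - f) =ᶠ[l] evolFun 𝒰 t g - g :=
    (hT.ev_sub _ _).trans (((hT.ev_apply t f).trans (hT.evolFun_congr t _ _ hf)).sub hf)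
  have hz : ∀ τ, b + 1 ≤ τ → 𝒰.U τ (τ - t) (g (τ - t)) - g τ = 0 := fun τ hτ => by
    rw [hgb τ (le_self_add.trans hτ), hgb (τ - t), map_zero, sub_zero]
    exact le_tsub_of_add_le_right ((add_le_add_right ht1 b).trans hτ)
  have hn : ‖T t f - f‖ ≤ (1 + (b + 1 : ℝ≥0)) * δ := by
    refine hT.norm_le _ 0 (b + 1) δ hδ0.le (e.mono fun τ h => ?_) (.of_forall fun τ h => ?_)
      (e.mono fun τ h hτ => ?_)
    · rw [h, Pi.sub_apply, evolFun_eq_of_zero t hg0]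
      rcases le_total τ (b + 1) with h' | h'
      · exact (ht τ ⟨zero_le, h'⟩).le
      · rw [hz τ h', norm_zero]
        exact hδ0.le
    · exact absurd h not_lt_zero
    · rw [h, Pi.sub_apply, evolFun_eq_of_zero t hg0]
      exact hz τ (by simpa using hτ)
  rw [dist_eq_norm]
  refine hn.trans_lt ?_
  rw [hδ]
  field_simp
  linarith

include hT h𝒰 in
theorem IsEvolution.bound : ∃ M ω : ℝ, 0 ≤ M ∧ ∀ t : ℝ≥0, ‖T t‖ ≤ M * Real.exp (ω * t) := by
  obtain ⟨M, ω, hM, h⟩ := h𝒰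
  have hM0 : 0 ≤ M := zero_le_one.trans hM
  refine ⟨M, ω, hM0, fun t => ?_⟩
  have hp : 0 ≤ M * Real.exp (ω * t) := by positivity
  rw [← Real.coe_toNNReal _ hp]
  refine hT.norm_apply_le t _ fun σ => ?_
  rw [Real.coe_toNNReal _ hp]
  simpa using h (σ + t) σ le_self_add

include hT h𝒰 in
theorem tendsto_apply_zero (f : F) : Tendsto (fun t => T t f) (𝓝 0) (𝓝 f) := by
  obtain ⟨M, ω, hM, hb⟩ := hT.bound h𝒰
  have hC : ∀ᶠ t : ℝ≥0 in 𝓝 0, M * Real.exp (ω * t) < M + 1 := by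
    have : Continuous fun t : ℝ≥0 => M * Real.exp (ω * t) := by fun_prop
    exact this.continuousAt.eventually_lt_const (by simp)
  rw [Metric.tendsto_nhds]
  intro ε hε
  -- The error `‖f - g‖` enters once directly and once multiplied by `M + 1`, which costs at most `ε
  -- / 2` in total.
  obtain ⟨g, hfg, k, b, hk, hk0, hkb, hg⟩ := Metric.dense_iff.1 hT.dense f
    (ε / (2 * (M + 2))) (by positivity)
  rw [Metric.mem_ball, dist_comm, dist_eq_norm, lt_div_iff₀ (by positivity)] at hfg
  filter_upwards [hC, Metric.tendsto_nhds.1 (tendsto_apply_of_continuous hT h𝒰 hk hk0 hkb hg)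
    (ε / 2) (by positivity)] with t h1 h2
  rw [dist_eq_norm] at h2 ⊢
  have h3 : ‖T t (f - g)‖ ≤ (M + 1) * ‖f - g‖ :=
    ContinuousLinearMap.le_of_opNorm_le _ ((hb t).trans h1.le) _
  have e : T t f - f = T t (f - g) + (T t g - g) - (f - g) := by
    rw [map_sub]
    abel
  rw [e]
  calc _ ≤ ‖T t (f - g)‖ + ‖T t g - g‖ + ‖f - g‖ :=
        (norm_sub_le _ _).trans (by gcongr; exact norm_add_le _ _)
    _ < ε := by linarith

include hT h𝒰 in
theorem IsEvolution.isC0Semigroup : IsC0Semigroup T := by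
  have hadd : ∀ s t, T (s + t) = T s * T t := fun s t => by
    refine ContinuousLinearMap.ext fun f => hT.ext _ _ ?_
    rw [mul_apply_eq_comp]
    refine (hT.ev_apply _ _).trans ?_
    rw [← evolFun_evolFun]
    exact ((hT.ev_apply s (T t f)).trans (hT.evolFun_congr s _ _ (hT.ev_apply t f))).symm
  have hb := hT.bound h𝒰
  refine ⟨?_, hadd, fun x => ?_, hb⟩
  · refine ContinuousLinearMap.ext fun f => hT.ext _ _ ?_
    have := hT.ev_apply 0 f
    rwa [evolFun_zero] at this
  · obtain ⟨M, ω, hM, hb⟩ := hb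
    rw [continuous_iff_continuousAt]
    intro t₀
    -- The sum of the two truncated differences is `|t - t₀|`. Factoring out `T(min t t₀)` reduces
    -- continuity at `t₀` to continuity at `0`.
    have hd : Tendsto (fun t : ℝ≥0 => (t - t₀) + (t₀ - t)) (𝓝 t₀) (𝓝 0) :=
      Continuous.tendsto' (by fun_prop) _ _ (by simp)
    have hz := (((tendsto_apply_zero hT h𝒰 x).comp hd).sub_const x).norm
    rw [sub_self, norm_zero] at hz
    have hm : Tendsto (fun t : ℝ≥0 => M * Real.exp (ω * (min t t₀ : ℝ≥0))) (𝓝 t₀)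
        (𝓝 (M * Real.exp (ω * t₀))) := Continuous.tendsto' (by fun_prop) _ _ (by simp)
    have hp := hm.mul hz
    rw [mul_zero] at hp
    refine tendsto_iff_norm_sub_tendsto_zero.2 (squeeze_zero (fun _ => norm_nonneg _)
      (fun t => ?_) hp)
    rcases le_total t₀ t with h | h
    · have e : T t x - T t₀ x = T t₀ (T (t - t₀) x - x) := by
        rw [map_sub, ← mul_apply_eq_comp, ← hadd, add_tsub_cancel_of_le h]
      simp only [Function.comp, min_eq_right h, tsub_eq_zero_of_le h, add_zero, e]
      exact ContinuousLinearMap.le_of_opNorm_le _ (hb t₀) _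
    · have e : T t₀ x - T t x = T t (T (t₀ - t) x - x) := by
        rw [map_sub, ← mul_apply_eq_comp, ← hadd, add_tsub_cancel_of_le h]
      rw [norm_sub_rev]
      simp only [Function.comp, min_eq_left h, tsub_eq_zero_of_le h, zero_add, e]
      exact ContinuousLinearMap.le_of_opNorm_le _ (hb t) _

end Model

/-! ### Invertibility of the generator implies exponential stability -/

section Stability

variable {F : Type*} [NormedAddCommGroup F] [NormedSpace ℂ F]
variable {X : Type*} [NormedAddCommGroup X] [NormedSpace ℂ X]

/-- The average of `f` lies in the closed convex set `S`, and the integral is a multiple of it. -/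
theorem intervalIntegral_mem_of_isClosed [CompleteSpace F] {S : Submodule ℂ F}
    (hS : IsClosed (S : Set F)) {f : ℝ → F} (hf : Continuous f) (h : ∀ t, f t ∈ S) {a b : ℝ}
    (hab : a ≤ b) : ∫ t in a..b, f t ∈ S := by
  rcases hab.eq_or_lt with rfl | hab
  · simp
  have hv : (volume : Measure ℝ).real (Set.Ioc a b) = b - a := Real.volume_real_Ioc_of_le hab.le
  have := (S.restrictScalars ℝ).convex.set_average_mem (μ := volume) (t := Set.Ioc a b) hS
    (by simpa using hab) (by simp) (.of_forall h)
    (hf.integrableOn_Icc.mono_set Set.Ioc_subset_Icc_self)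
  rw [setAverage_eq, hv] at this
  have h2 := (S.restrictScalars ℝ).smul_mem (b - a) this
  rw [smul_smul, mul_inv_cancel₀ (sub_pos.2 hab).ne', one_smul] at h2
  rwa [intervalIntegral.integral_of_le hab.le]

variable {𝒰 : EvolutionFamily X} {l : Filter ℝ≥0} {ev : F → ℝ≥0 → X} {T : ℝ≥0 → F →L[ℂ] F}

/-- Causality: `f = T(a) f - ∫₀ᵃ T(s) g ds`. The first term vanishes on `[0, a)` by the definition
of `E^a`, the second because the semigroup preserves the closed subspace containing `g`. -/
theorem IsEvolution.mem_vanishing_of_hasGenerator [CompleteSpace F] (hT : IsEvolution 𝒰 l ev T)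
    (h𝒰 : 𝒰.ExponentiallyBounded) {a : ℝ≥0} {f g : F} (h : HasGenerator T f g)
    (hg : g ∈ hT.vanishing a) : f ∈ hT.vanishing a := by
  have hs := hT.isC0Semigroup h𝒰
  have h1 : orbitIntegral hs a g ∈ hT.vanishing a :=
    intervalIntegral_mem_of_isClosed (hT.isClosed_vanishing a) (hs.continuous_orbit g)
      (fun t => hT.apply_mem_vanishing hg _) a.coe_nonneg
  have h2 := orbitIntegral_generator hs a h
  have h3 := (hT.vanishing a).sub_mem (hT.apply_mem_vanishing_self a f) h1
  rwa [h2, sub_sub_cancel] at h3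

/-! ### Weighted orbits as test functions. -/

/-- The orbit `τ ↦ U(τ, s) x`, extended by the constant `x` to `[0, s]`. -/
def EvolutionFamily.orbit (𝒰 : EvolutionFamily X) (s : ℝ≥0) (x : X) (τ : ℝ≥0) : X :=
  𝒰.U (max τ s) s x

theorem EvolutionFamily.orbit_of_le (𝒰 : EvolutionFamily X) {s τ : ℝ≥0} (h : s ≤ τ) (x : X) :
    𝒰.orbit s x τ = 𝒰.U τ s x := by
  rw [EvolutionFamily.orbit, max_eq_left h]

theorem EvolutionFamily.continuous_orbit (𝒰 : EvolutionFamily X) (s : ℝ≥0) (x : X) :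
    Continuous (𝒰.orbit s x) :=
  (𝒰.continuousOn x).comp_continuous (f := fun τ : ℝ≥0 => (max τ s, s)) (by fun_prop)
    (fun τ => show s ≤ max τ s from le_max_right _ _)

/-- As `U(τ, τ-h) U(τ-h, s) x = U(τ, s) x`, only the weight is translated. The artificial values of
the orbit before `s` are killed by `φ`. -/
theorem evolFun_smul_orbit (𝒰 : EvolutionFamily X) {φ : ℝ → ℝ} {s : ℝ≥0}
    (hφ : ∀ r ≤ (s : ℝ), φ r = 0) (h : ℝ≥0) (x : X) (τ : ℝ≥0) :
    evolFun 𝒰 h (fun τ => (φ τ : ℂ) • 𝒰.orbit s x τ) τ = (φ (τ - h) : ℂ) • 𝒰.orbit s x τ := by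
  by_cases h1 : h ≤ τ
  · simp only [evolFun, h1, if_true, map_smul, NNReal.coe_sub h1]
    by_cases h2 : s ≤ τ - h
    · have h3 := h2.trans tsub_le_self
      rw [𝒰.orbit_of_le h2, 𝒰.orbit_of_le h3, 𝒰.comp τ (τ - h) s h2 tsub_le_self]
      rfl
    · have : ((τ : ℝ) - h) ≤ s := by
        rw [← NNReal.coe_sub h1]
        exact_mod_cast (not_le.1 h2).le
      simp [hφ _ this]
  · have h2 : (τ : ℝ) ≤ h := by exact_mod_cast (not_le.1 h1).le
    have : ((τ : ℝ) - h) ≤ s := by linarith [s.coe_nonneg]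
    simp [evolFun, h1, hφ _ this]

/-- By the translation formula for weighted orbits, the difference quotient acts on the scalar
weight `φ` alone. It converges uniformly to `-φ'`, and the supports stay in a fixed bounded
interval, where the orbit is bounded. -/
theorem IsEvolution.hasGenerator_smul_orbit (hT : IsEvolution 𝒰 l ev T) {φ : ℝ → ℝ}
    (hφ : ContDiff ℝ 1 φ) {s b : ℝ≥0} (hs : ∀ r ≤ (s : ℝ), φ r = 0) (hb : ∀ r ≥ (b : ℝ), φ r = 0)
    {x : X} {f g : F} (hf : ev f =ᶠ[l] fun τ => (φ τ : ℂ) • 𝒰.orbit s x τ)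
    (hg : ev g =ᶠ[l] fun τ => -((deriv φ τ : ℝ) : ℂ) • 𝒰.orbit s x τ) : HasGenerator T f g := by
  have hsupp : HasCompactSupport φ := 
    HasCompactSupport.intro (isCompact_Icc (a := (s : ℝ)) (b := b)) fun r hr => by
      rcases le_total r s with h | h
      · exact hs r h
      · exact hb r (le_of_not_ge fun h' => hr ⟨h, h'⟩)
  have hd : Continuous (deriv φ) := hφ.continuous_deriv le_rfl
  have hdb : ∀ r > (b : ℝ), deriv φ r = 0 := fun r hr => by
    have : φ =ᶠ[𝓝 r] fun _ => 0 := by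
      filter_upwards [lt_mem_nhds hr] with r' hr'
      exact hb r' (le_of_lt hr')
    rw [this.deriv_eq, deriv_const]
  obtain ⟨B, hB⟩ := (isCompact_Icc (a := (0 : ℝ≥0)) (b := b + 1)).exists_bound_of_continuousOn
    (𝒰.continuous_orbit s x).continuousOn
  have hB0 : 0 ≤ B := (norm_nonneg _).trans (hB 0 ⟨le_rfl, zero_le⟩)
  have huc : UniformContinuous (deriv φ) := hsupp.deriv.uniformContinuous_of_continuous hd
  rw [HasGenerator, Metric.tendsto_nhds]
  intro ε hε
  -- Chosen so that support factor times `η (B + 1)` is `ε / 2`; `B + 1` avoids dividing by zero.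
  set η : ℝ := ε / (2 * ((1 + (b + 2 : ℝ≥0)) * (B + 1))) with hη
  have hη0 : 0 < η := by positivity
  obtain ⟨δ, hδ, huc⟩ := Metric.uniformContinuous_iff.1 huc η hη0
  have hh : ∀ᶠ h : ℝ≥0 in 𝓝[>] 0, (h : ℝ) < δ := by
    refine mem_nhdsWithin_of_mem_nhds ?_
    exact NNReal.continuous_coe.continuousAt.eventually_lt_const (by simpa using hδ)
  have hh1 : ∀ᶠ h : ℝ≥0 in 𝓝[>] 0, h ≤ 1 :=
    mem_nhdsWithin_of_mem_nhds (eventually_le_nhds (show (0 : ℝ≥0) < 1 by norm_num))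
  filter_upwards [hh, hh1, self_mem_nhdsWithin] with h h1 h2 h3
  have hpos : (0 : ℝ) < h := h3
  have key : ev (diffQuot T f h - g) =ᶠ[l] fun τ =>
      ((deriv φ τ - (φ τ - φ (τ - h)) / h : ℝ) : ℂ) • 𝒰.orbit s x τ := by
    have e1 := (hT.ev_apply h f).trans (hT.evolFun_congr h _ _ hf)
    filter_upwards [e1, hf, hg, hT.ev_sub (diffQuot T f h) g,
      hT.ev_smul ((h : ℝ) : ℂ)⁻¹ (T h f - f), hT.ev_sub (T h f) f] with τ a1 a2 a3 a4 a5 a6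
    rw [a4, Pi.sub_apply, diffQuot, a5, Pi.smul_apply, a6, Pi.sub_apply, a1, a2, a3,
      evolFun_smul_orbit 𝒰 hs, ← sub_smul, smul_smul, ← sub_smul]
    congr 1
    push_cast
    have : ((h : ℝ) : ℂ) ≠ 0 := by exact_mod_cast hpos.ne'
    field_simp
    ring
  have hn : ‖diffQuot T f h - g‖ ≤ (1 + (b + 2 : ℝ≥0)) * (η * B) := by
    have hz : ∀ τ : ℝ≥0, b + 1 < τ → deriv φ τ - (φ τ - φ (τ - h)) / h = 0 := fun τ hτ => by
      have hτ' : (b : ℝ) + 1 < τ := by exact_mod_cast hτ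
      have h2' : (h : ℝ) ≤ 1 := by exact_mod_cast h2
      rw [hdb _ (by linarith), hb τ (by linarith), hb (τ - h) (by linarith)]
      simp
    refine hT.norm_le _ 0 (b + 2) _ (by positivity) (key.mono fun τ e => ?_)
      (.of_forall fun τ h => absurd h not_lt_zero) (key.mono fun τ e hτ => ?_)
    · rw [e]
      rcases le_or_gt τ (b + 1) with h' | h'
      · rw [norm_smul, Complex.norm_real]
        refine mul_le_mul ?_ (hB τ ⟨zero_le, h'⟩) (norm_nonneg _) hη0.le
        -- The mean value theorem turns the quotient into `φ'` at a point within `h < δ` of `τ`,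
        -- where uniform continuity applies.
        obtain ⟨c, hc, hc'⟩ := exists_deriv_eq_slope φ (show (τ : ℝ) - h < τ by linarith)
          hφ.continuous.continuousOn (hφ.differentiable one_ne_zero).differentiableOn
        rw [sub_sub_cancel] at hc'
        rw [← hc', ← dist_eq_norm]
        refine (huc ?_).le
        rw [Real.dist_eq, abs_lt]
        constructor <;> linarith [hc.1, hc.2]
      · beta_reduce
        rw [hz τ h', Complex.ofReal_zero, zero_smul, norm_zero]
        positivity
    · rw [e]
      beta_reduce
      rw [hz τ, Complex.ofReal_zero, zero_smul]
      refine lt_of_lt_of_le ?_ hτ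
      rw [zero_add]
      gcongr
      norm_num
  rw [dist_eq_norm]
  refine hn.trans_lt ?_
  have : (1 + ((b + 2 : ℝ≥0) : ℝ)) * (η * B) ≤ (1 + (b + 2 : ℝ≥0)) * (η * (B + 1)) := by
    gcongr
    linarith
  refine this.trans_lt ?_
  rw [hη]
  field_simp
  linarith

/-- Such a point is a global minimum, which also covers the endpoint `0`. -/
theorem deriv_smoothTransition_of_nonpos {r : ℝ} (hr : r ≤ 0) :
    deriv Real.smoothTransition r = 0 :=
  IsLocalMin.deriv_eq_zero (.of_forall fun y => by
    rw [Real.smoothTransition.zero_of_nonpos hr]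
    exact Real.smoothTransition.nonneg y)

theorem deriv_smoothTransition_of_one_le {r : ℝ} (hr : 1 ≤ r) :
    deriv Real.smoothTransition r = 0 :=
  IsLocalMax.deriv_eq_zero (.of_forall fun y => by
    rw [Real.smoothTransition.one_of_one_le hr]
    exact Real.smoothTransition.le_one y)

theorem continuous_deriv_smoothTransition : Continuous (deriv Real.smoothTransition) :=
  (Real.smoothTransition.contDiff (n := 1)).continuous_deriv le_rfl

theorem exists_bound_deriv_smoothTransition :
    ∃ D : ℝ, 0 ≤ D ∧ ∀ r, ‖deriv Real.smoothTransition r‖ ≤ D := by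
  obtain ⟨D, hD⟩ := (isCompact_Icc (a := (0 : ℝ)) (b := 1)).exists_bound_of_continuousOn
    continuous_deriv_smoothTransition.continuousOn
  have hD0 : 0 ≤ D := (norm_nonneg _).trans (hD 0 ⟨le_rfl, zero_le_one⟩)
  refine ⟨D, hD0, fun r => ?_⟩
  rcases le_total r 0 with h | h
  · rwa [deriv_smoothTransition_of_nonpos h, norm_zero]
  rcases le_total 1 r with h' | h'
  · rwa [deriv_smoothTransition_of_one_le h', norm_zero]
  exact hD r ⟨h, h'⟩

theorem EvolutionFamily.ExponentiallyBounded.exists_local_bound (h𝒰 : 𝒰.ExponentiallyBounded)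
    (d : ℝ≥0) : ∃ B : ℝ, 1 ≤ B ∧ ∀ t τ : ℝ≥0, τ ≤ t → t ≤ τ + d → ‖𝒰.U t τ‖ ≤ B := by
  obtain ⟨M, ω, hM, h⟩ := h𝒰
  refine ⟨M * Real.exp (|ω| * d), ?_, fun t τ h1 h2 => (h t τ h1).trans ?_⟩
  · exact one_le_mul_of_one_le_of_one_le hM (Real.one_le_exp (by positivity))
  · have h1' : (τ : ℝ) ≤ t := h1
    have h2' : (t : ℝ) ≤ τ + d := h2
    gcongr
    · exact le_abs_self ω
    · linarith

/-- The orbit `U(·, s) x`, weighted with the derivative of a smooth step at `a`, belongs to the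
function space. -/
theorem IsFunctionSpace.exists_bump (hF : IsFunctionSpace l ev) (𝒰 : EvolutionFamily X)
    (s a : ℝ≥0) (x : X) :
    ∃ f, ev f =ᶠ[l] fun τ => ((deriv Real.smoothTransition (τ - a) : ℝ) : ℂ) • 𝒰.orbit s x τ := by
  refine hF.exists_rep _ (a + 1) ?_ ?_ fun τ hτ => ?_
  · have := 𝒰.continuous_orbit s x
    have := continuous_deriv_smoothTransition
    fun_prop
  · rw [deriv_smoothTransition_of_nonpos (by simp), Complex.ofReal_zero, zero_smul]
  · have : (a : ℝ) + 1 ≤ τ := by exact_mod_cast hτ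
    rw [deriv_smoothTransition_of_one_le (by linarith), Complex.ofReal_zero, zero_smul]

/-- The operator `R = -Γ⁻¹` must propagate a bump placed after time `s` along the whole orbit up to
time `t`, yet its norm does not depend on `t - s`. Comparing the sizes of input and output bounds
`U(t,s)`. -/
theorem IsEvolution.exists_bound_of_zero_mem_resolventSet [CompleteSpace F]
    (hT : IsEvolution 𝒰 l ev T) (h𝒰 : 𝒰.ExponentiallyBounded)
    (h0 : (0 : ℂ) ∈ operatorResolventSet (generator T)) :
    ∃ C : ℝ, 0 ≤ C ∧ ∀ t s : ℝ≥0, s ≤ t → ‖𝒰.U t s‖ ≤ C := by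
  obtain ⟨R, hR, -⟩ := mem_operatorResolventSet_iff.1 h0
  obtain ⟨D, hD0, hD⟩ := exists_bound_deriv_smoothTransition
  obtain ⟨B, hB1, hB⟩ := h𝒰.exists_local_bound 2
  have hB0 : 0 ≤ B := zero_le_one.trans hB1
  -- For `t ≤ s + 2` the local bound suffices. Otherwise `(1 + 1) (D * B)` bounds the input bump,
  -- and the outer `B` pays for going from a time in `[t-1, t)` to `t`.
  refine ⟨max B (B * (‖R‖ * ((1 + 1) * (D * B)))), hB0.trans (le_max_left _ _), fun t s hst => ?_⟩
  rcases le_total t (s + 2) with ht | ht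
  · exact (hB t s hst ht).trans (le_max_left _ _)
  refine le_trans ?_ (le_max_right _ _)
  refine ContinuousLinearMap.opNorm_le_bound _ (by positivity) fun x => ?_
  obtain ⟨f₁, hf₁⟩ := hT.exists_bump 𝒰 s s x
  obtain ⟨f₂, hf₂⟩ := hT.exists_bump 𝒰 s t x
  have hst' : (s : ℝ) + 2 ≤ t := by exact_mod_cast ht
  -- This weight is `1` on `[s + 1, t]`, and its derivative is a bump after `s` minus a bump after
  -- `t`.
  set φ : ℝ → ℝ := fun r => Real.smoothTransition (r - s) - Real.smoothTransition (r - t) with hφ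
  have hφs : ∀ r ≤ (s : ℝ), φ r = 0 := fun r hr => by
    simp only [hφ]
    rw [Real.smoothTransition.zero_of_nonpos (by linarith),
      Real.smoothTransition.zero_of_nonpos (by linarith), sub_zero]
  have hφt : ∀ r ≥ ((t + 1 : ℝ≥0) : ℝ), φ r = 0 := fun r hr => by
    have hr' : (t : ℝ) + 1 ≤ r := by exact_mod_cast hr
    simp only [hφ]
    rw [Real.smoothTransition.one_of_one_le (by linarith),
      Real.smoothTransition.one_of_one_le (by linarith), sub_self]
  have hφc : ContDiff ℝ 1 φ :=
    (Real.smoothTransition.contDiff.comp (contDiff_id.sub contDiff_const)).sub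
      (Real.smoothTransition.contDiff.comp (contDiff_id.sub contDiff_const))
  have hφd : ∀ r, deriv φ r =
      deriv Real.smoothTransition (r - s) - deriv Real.smoothTransition (r - t) := fun r => by
    have hd : Differentiable ℝ Real.smoothTransition :=
      (Real.smoothTransition.contDiff (n := 1)).differentiable one_ne_zero
    have h1 : ∀ a : ℝ, HasDerivAt (fun r => Real.smoothTransition (r - a))
        (deriv Real.smoothTransition (r - a)) r := fun a =>
      (hd (r - a)).hasDerivAt.comp_sub_const r a
    exact ((h1 s).sub (h1 t)).deriv
  obtain ⟨u, hu⟩ : ∃ u, ev u =ᶠ[l] fun τ => (φ τ : ℂ) • 𝒰.orbit s x τ := by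
    refine hT.exists_rep _ (t + 1) ?_ ?_ fun τ hτ => ?_
    · have := 𝒰.continuous_orbit s x
      have := hφc.continuous
      fun_prop
    · rw [hφs _ (by simp), Complex.ofReal_zero, zero_smul]
    · rw [hφt τ (by exact_mod_cast hτ), Complex.ofReal_zero, zero_smul]
  have hgu : HasGenerator T u (f₂ - f₁) := by
    refine hT.hasGenerator_smul_orbit hφc hφs hφt hu ?_
    filter_upwards [hf₁, hf₂, hT.ev_sub f₂ f₁] with τ a1 a2 a3
    rw [a3, Pi.sub_apply, a1, a2, hφd, ← sub_smul]
    push_cast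
    congr 1
    ring
  -- The bump at `s` cancels: `Γ (R f₁) = -f₁` and `Γ u = f₂ - f₁`. What remains lives after `t`, so
  -- causality gives `R f₁ = u` before `t`.
  have hgw : HasGenerator T (R f₁ - u) (-f₂) := by
    convert (hR f₁).sub hgu using 1
    rw [zero_smul]
    abel
  have hf₂v : -f₂ ∈ hT.vanishing t := by
    refine (hT.vanishing t).neg_mem (hf₂.mono fun τ h hτ => ?_)
    have : (τ : ℝ) ≤ t := by exact_mod_cast hτ.le
    rw [h]
    beta_reduce
    rw [deriv_smoothTransition_of_nonpos (by linarith), Complex.ofReal_zero, zero_smul]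
  have hv := hT.mem_vanishing_of_hasGenerator h𝒰 hgw hf₂v
  have hf₁n : ‖f₁‖ ≤ (1 + (1 : ℝ≥0)) * (D * (B * ‖x‖)) := by
    refine hT.norm_le f₁ s 1 _ (by positivity) (hf₁.mono fun τ h => ?_)
      (hf₁.mono fun τ h hτ => ?_) (hf₁.mono fun τ h hτ => ?_)
    · rw [h, norm_smul, Complex.norm_real]
      rcases le_total τ (s + 2) with h' | h'
      · refine mul_le_mul (hD _) ?_ (norm_nonneg _) hD0
        refine ContinuousLinearMap.le_of_opNorm_le _ (hB _ _ (le_max_right _ _) ?_) _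
        exact max_le h' le_self_add
      · have : (s : ℝ) + 2 ≤ τ := by exact_mod_cast h'
        rw [deriv_smoothTransition_of_one_le (by linarith), norm_zero, zero_mul]
        positivity
    · have : (τ : ℝ) ≤ s := by exact_mod_cast hτ.le
      rw [h]
      beta_reduce
      rw [deriv_smoothTransition_of_nonpos (by linarith), Complex.ofReal_zero, zero_smul]
    · have : (s : ℝ) + 1 ≤ τ := by exact_mod_cast hτ
      rw [h]
      beta_reduce
      rw [deriv_smoothTransition_of_one_le (by linarith), Complex.ofReal_zero, zero_smul]
  have ht1 : (1 : ℝ≥0) ≤ t := by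
    refine le_trans ?_ ht
    refine le_add_of_nonneg_of_le zero_le (by norm_num)
  -- On `[t-1, t)` the weight is `1` because `t - 1 ≥ s + 1`. There `R f₁` is the orbit, and `U(t,s)
  -- x = U(t,τ) U(τ,s) x` with `t - τ ≤ 1`.
  have hlow : ‖𝒰.U t s x‖ / B ≤ ‖R f₁‖ := by
    refine hT.le_norm _ (t - 1) _ ?_
    filter_upwards [hv, hT.ev_sub (R f₁) u, hu] with τ a1 a2 a3 hτ1 hτ2
    rw [tsub_add_cancel_of_le ht1] at hτ2
    have a4 := a1 hτ2
    have b1 : (τ : ℝ) < t := hτ2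
    have b2 : (t : ℝ) - 1 ≤ τ := by
      have : ((t - 1 : ℝ≥0) : ℝ) ≤ τ := hτ1
      rwa [NNReal.coe_sub ht1, NNReal.coe_one] at this
    have hsτ : s ≤ τ := by
      rw [← NNReal.coe_le_coe]
      linarith
    have hφ1 : φ τ = 1 := by
      simp only [hφ]
      rw [Real.smoothTransition.one_of_one_le (by linarith),
        Real.smoothTransition.zero_of_nonpos (by linarith), sub_zero]
    rw [a2, Pi.sub_apply, sub_eq_zero, a3, hφ1, Complex.ofReal_one, one_smul,
      𝒰.orbit_of_le hsτ] at a4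
    rw [a4, div_le_iff₀ (by linarith), mul_comm, 𝒰.comp t τ s hsτ hτ2.le]
    refine ContinuousLinearMap.le_of_opNorm_le _ (hB _ _ hτ2.le ?_) _
    rw [← NNReal.coe_le_coe]
    push_cast
    linarith
  rw [div_le_iff₀ (by linarith)] at hlow
  calc _ ≤ ‖R f₁‖ * B := hlow
    _ ≤ (‖R‖ * ((1 + (1 : ℝ≥0)) * (D * (B * ‖x‖)))) * B := by
        gcongr
        exact (R.le_opNorm f₁).trans (by gcongr)
    _ = _ := by
        push_cast
        ring

/-- Uniform boundedness of the family rescaled at the resolvent point `-ν` is decay of the original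
one at rate `ν`. -/
theorem IsEvolution.exists_decay [CompleteSpace F] (hT : IsEvolution 𝒰 l ev T)
    (h𝒰 : 𝒰.ExponentiallyBounded) (h0 : (0 : ℂ) ∈ operatorResolventSet (generator T)) :
    ∃ N ν : ℝ, 0 < ν ∧ ∀ t : ℝ≥0, ‖T t‖ ≤ N * Real.exp (-ν * t) := by
  obtain ⟨ν, hν, h⟩ := neg_mem_resolventSet h0
  have h1 : (0 : ℂ) ∈ operatorResolventSet (generator (rescale T ((-ν : ℝ) : ℂ))) := by
    rwa [mem_operatorResolventSet_rescale_iff, add_zero]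
  obtain ⟨C, hC0, hC⟩ := (hT.rescaled _).exists_bound_of_zero_mem_resolventSet (h𝒰.rescaled _) h1
  refine ⟨C, ν, hν, fun t => ?_⟩
  have h2 := (hT.rescaled ((-ν : ℝ) : ℂ)).norm_apply_le t C.toNNReal fun σ => by
    rw [Real.coe_toNNReal _ hC0]
    exact hC _ _ le_self_add
  rw [norm_rescale, Real.coe_toNNReal _ hC0, Complex.ofReal_re, neg_neg] at h2
  rw [neg_mul, Real.exp_neg, ← div_eq_mul_inv, le_div_iff₀ (Real.exp_pos _), mul_comm]
  exact h2

/-! ### The spectral mapping theorem -/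

variable [CompleteSpace F] (hT : IsEvolution 𝒰 l ev T) (h𝒰 : 𝒰.ExponentiallyBounded)

include hT h𝒰

/-- Each point of the resolvent set has an open right half-plane around it on which all
`1 - e^{-wt} T(t)`, `t > 0`, are invertible. -/
theorem IsEvolution.exists_halfPlane_isUnit {z : ℂ}
    (hz : z ∈ operatorResolventSet (generator T)) :
    ∃ ν : ℝ, 0 < ν ∧ ∀ w : ℂ, z.re - ν < w.re → ∀ t : ℝ≥0, 0 < t → IsUnit (1 - rescale T w t) := by
  obtain ⟨N, ν, hν, h⟩ := (hT.rescaled z).exists_decay (h𝒰.rescaled z)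
    (by rwa [mem_operatorResolventSet_rescale_iff, add_zero])
  refine ⟨ν, hν, fun w hw t ht => ?_⟩
  refine isUnit_one_sub_of_decay ((hT.isC0Semigroup h𝒰).rescaled w) (N := N)
    (ν := ν + (w.re - z.re)) (by linarith) (fun t => ?_) ht
  have h1 := h t
  rw [norm_rescale] at h1 ⊢
  have e : Real.exp (-w.re * t) = Real.exp (-(w.re - z.re) * t) * Real.exp (-z.re * t) := by
    rw [← Real.exp_add]
    ring_nf
  rw [e, mul_assoc]
  calc _ ≤ Real.exp (-(w.re - z.re) * t) * (N * Real.exp (-ν * t)) := by gcongr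
    _ = _ := by
      rw [mul_left_comm, ← Real.exp_add]
      ring_nf

theorem IsEvolution.mem_resolventSet_iff {t : ℝ≥0} (ht : 0 < t) {z : ℂ} :
    z ∈ operatorResolventSet (generator T) ↔ IsUnit (1 - rescale T z t) := by
  refine ⟨fun h => ?_, mem_resolventSet_of_isUnit (hT.isC0Semigroup h𝒰)⟩
  obtain ⟨ν, hν, h⟩ := hT.exists_halfPlane_isUnit h𝒰 h
  exact h z (by linarith) t ht

/-- Pulling out the nonzero scalar, `e^{tz} - T(t) = e^{tz} (1 - e^{-zt} T(t))`. -/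
theorem IsEvolution.mem_operatorSpectrum_iff {t : ℝ≥0} (ht : 0 < t) {z : ℂ} :
    z ∈ operatorSpectrum (generator T) ↔ Complex.exp (((t : ℝ) : ℂ) * z) ∈ spectrum ℂ (T t) := by
  rw [operatorSpectrum, Set.mem_compl_iff, hT.mem_resolventSet_iff h𝒰 ht, spectrum.mem_iff]
  refine not_congr ?_
  have e : algebraMap ℂ (F →L[ℂ] F) (Complex.exp (((t : ℝ) : ℂ) * z)) - T t =
      Complex.exp (((t : ℝ) : ℂ) * z) • (1 - rescale T z t) := by
    rw [smul_sub, rescale, smul_smul, ← Complex.exp_add, Algebra.algebraMap_eq_smul_one]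
    ring_nf
    simp
  rw [e]
  exact (isUnit_smul_iff (Units.mk0 _ (Complex.exp_ne_zero (((t : ℝ) : ℂ) * z))) _).symm

theorem IsEvolution.exists_operatorSpectrum_eq : ∃ s : EReal, s < ⊤ ∧
    operatorSpectrum (generator T) = {z : ℂ | (z.re : EReal) ≤ s} := by
  -- The spectral bound; in `EReal` the supremum of the empty set is `⊥`, which covers an empty
  -- spectrum. It is finite above by the growth bound `ω`.
  refine ⟨sSup ((fun z : ℂ => (z.re : EReal)) '' operatorSpectrum (generator T)), ?_, ?_⟩
  · obtain ⟨M, ω, hM, hb⟩ := hT.bound h𝒰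
    refine lt_of_le_of_lt (sSup_le ?_) (EReal.coe_lt_top ω)
    rintro _ ⟨z, hz, rfl⟩
    rw [EReal.coe_le_coe_iff]
    by_contra hlt
    rw [not_le] at hlt
    refine hz ((hT.mem_resolventSet_iff h𝒰 one_pos).2 ?_)
    refine isUnit_one_sub_of_decay ((hT.isC0Semigroup h𝒰).rescaled z) (N := M) (ν := z.re - ω)
      (by linarith) (fun t => ?_) one_pos
    rw [norm_rescale]
    calc _ ≤ Real.exp (-z.re * t) * (M * Real.exp (ω * t)) := by gcongr; exact hb t
      _ = _ := by
        rw [mul_left_comm, ← Real.exp_add]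
        ring_nf
  · ext z
    refine ⟨fun hz => le_sSup (Set.mem_image_of_mem (fun z : ℂ => (z.re : EReal)) hz),
      fun hz hz' => ?_⟩
    -- A resolvent point `z` left of or on the line `Re = s` would clear everything with real part
    -- above `z.re - ν`, pushing the supremum below `z.re`.
    obtain ⟨ν, hν, h⟩ := hT.exists_halfPlane_isUnit h𝒰 hz'
    have h1 : sSup ((fun z : ℂ => (z.re : EReal)) '' operatorSpectrum (generator T)) ≤
        ((z.re - ν : ℝ) : EReal) := by
      refine sSup_le ?_
      rintro _ ⟨w, hw, rfl⟩
      rw [EReal.coe_le_coe_iff]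
      by_contra hlt
      exact hw ((hT.mem_resolventSet_iff h𝒰 one_pos).2 (h w (not_le.1 hlt) 1 one_pos))
    have h2 := le_trans (show (z.re : EReal) ≤ _ from hz) h1
    rw [EReal.coe_le_coe_iff] at h2
    linarith

-- If `T(t)` were invertible, so would be `T(nt)`, whose range consists of functions vanishing on
-- `[0, nt)`. With `nt ≥ 3`, one fixed nonzero bump vanishing from `3` on contradicts surjectivity
-- for every `t`.
omit [CompleteSpace F] in
theorem IsEvolution.zero_mem_spectrum [Nontrivial X] {t : ℝ≥0} (ht : 0 < t) :
    (0 : ℂ) ∈ spectrum ℂ (T t) := by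
  rw [spectrum.zero_mem_iff]
  intro hu
  obtain ⟨x, hx⟩ := exists_ne (0 : X)
  obtain ⟨n, hn⟩ := exists_nat_gt (3 / t)
  have hn3 : 3 ≤ n * t := by
    rw [div_lt_iff₀ ht] at hn
    exact hn.le
  have hun := hu.pow n
  rw [(hT.isC0Semigroup h𝒰).pow] at hun
  set g : ℝ≥0 → X := fun τ =>
    ((Real.smoothTransition τ - Real.smoothTransition (τ - 2) : ℝ) : ℂ) • x with hg
  obtain ⟨f, hf⟩ : ∃ f, ev f =ᶠ[l] g := by
    refine hT.exists_rep g 3 ?_ ?_ fun τ hτ => ?_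
    · have := Real.smoothTransition.continuous
      fun_prop
    · simp only [hg, NNReal.coe_zero]
      rw [Real.smoothTransition.zero, Real.smoothTransition.zero_of_nonpos (by norm_num)]
      simp
    · have : (3 : ℝ) ≤ τ := by exact_mod_cast hτ
      simp only [hg]
      rw [Real.smoothTransition.one_of_one_le (by linarith),
        Real.smoothTransition.one_of_one_le (by linarith)]
      simp
  obtain ⟨v, hv⟩ := hun
  have e : T (n * t) (((v⁻¹ : (F →L[ℂ] F)ˣ) : F →L[ℂ] F) f) = f := by
    have := congrArg (fun A : F →L[ℂ] F => A f) v.mul_inv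
    rwa [hv] at this
  have hvan := hT.apply_mem_vanishing_self (n * t) (((v⁻¹ : (F →L[ℂ] F)ˣ) : F →L[ℂ] F) f)
  rw [e] at hvan
  have h1 : ‖x‖ ≤ ‖f‖ := by
    refine hT.le_norm f 1 _ (hf.mono fun τ h h1 h2 => ?_)
    have h1' : (1 : ℝ) ≤ τ := by exact_mod_cast h1
    have h2' : (τ : ℝ) < 1 + 1 := by exact_mod_cast h2
    rw [h]
    simp only [hg]
    rw [Real.smoothTransition.one_of_one_le h1',
      Real.smoothTransition.zero_of_nonpos (by linarith)]
    simp
  have h0 : ev f =ᶠ[l] 0 := by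
    filter_upwards [hvan, hf] with τ a1 a2
    rcases lt_or_ge τ (n * t) with h | h
    · exact a1 h
    · have : (3 : ℝ) ≤ τ := by exact_mod_cast hn3.trans h
      rw [a2]
      simp only [hg]
      rw [Real.smoothTransition.one_of_one_le (by linarith),
        Real.smoothTransition.one_of_one_le (by linarith)]
      simp
  rw [hT.ext f 0 (h0.trans hT.ev_zero.symm), norm_zero] at h1
  exact hx (norm_le_zero_iff.1 h1)

theorem IsEvolution.image_exp_operatorSpectrum {t : ℝ≥0} (ht : 0 < t) :
    (fun z : ℂ => Complex.exp (((t : ℝ) : ℂ) * z)) '' operatorSpectrum (generator T) =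
      spectrum ℂ (T t) \ {0} := by
  ext w
  constructor
  · rintro ⟨z, hz, rfl⟩
    exact ⟨(hT.mem_operatorSpectrum_iff h𝒰 ht).1 hz, Complex.exp_ne_zero _⟩
  · rintro ⟨hw, hw0⟩
    have ht' : ((t : ℝ) : ℂ) ≠ 0 := by exact_mod_cast ht.ne'
    -- One logarithm is enough: the equivalence holds for every `z`, so any solution of `e^{tz} = w`
    -- lies in the spectrum of the generator.
    have e : Complex.exp (((t : ℝ) : ℂ) * (Complex.log w / ((t : ℝ) : ℂ))) = w := by
      rw [mul_div_cancel₀ _ ht', Complex.exp_log hw0]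
    exact ⟨_, (hT.mem_operatorSpectrum_iff h𝒰 ht).2 (by rwa [e]), e⟩

theorem IsEvolution.exists_spectrum_eq_closedBall [Nontrivial X] {t : ℝ≥0} (ht : 0 < t) :
    ∃ r : ℝ, 0 ≤ r ∧ spectrum ℂ (T t) = Metric.closedBall (0 : ℂ) r := by
  obtain ⟨s, hs, hspec⟩ := hT.exists_operatorSpectrum_eq h𝒰
  have himg := hT.image_exp_operatorSpectrum h𝒰 ht
  have h0 := hT.zero_mem_spectrum h𝒰 ht
  have ht' : (0 : ℝ) < t := ht
  induction s with
  | top => exact absurd hs (lt_irrefl _)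
  | bot =>
    refine ⟨0, le_rfl, ?_⟩
    have : operatorSpectrum (generator T) = ∅ := by
      rw [hspec]
      ext z
      simp
    rw [this, Set.image_empty] at himg
    rw [Metric.closedBall_zero]
    exact (Set.sdiff_eq_empty.1 himg.symm).antisymm (Set.singleton_subset_iff.2 h0)
  | coe s =>
    -- The real part of `log w / t` is `log ‖w‖ / t`, so the condition `Re ≤ s` reads `‖w‖ ≤
    -- e^{ts}`.
    refine ⟨Real.exp (t * s), (Real.exp_pos _).le, ?_⟩
    ext w
    rw [mem_closedBall_zero_iff]
    by_cases hw : w = 0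
    · simp [hw, h0, (Real.exp_pos _).le]
    have ht'' : ((t : ℝ) : ℂ) ≠ 0 := by exact_mod_cast ht.ne'
    have e : Complex.exp (((t : ℝ) : ℂ) * (Complex.log w / ((t : ℝ) : ℂ))) = w := by
      rw [mul_div_cancel₀ _ ht'', Complex.exp_log hw]
    have h1 := hT.mem_operatorSpectrum_iff h𝒰 ht (z := Complex.log w / ((t : ℝ) : ℂ))
    rw [e, hspec, Set.mem_ofPred_eq, EReal.coe_le_coe_iff, Complex.div_ofReal_re,
      div_le_iff₀ ht', Complex.log_re] at h1
    rw [← h1, Real.log_le_iff_le_exp (norm_pos_iff.2 hw), mul_comm]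

end Stability

/-! ### The space `C₀₀(ℝ₊, X)` -/

section ContinuousFunctions

variable {X : Type*} [NormedAddCommGroup X]

theorem continuous_eval_zeroAtInfty (τ : ℝ≥0) : Continuous fun f : C₀(ℝ≥0, X) => f τ :=
  (continuous_eval_const (F := BoundedContinuousFunction ℝ≥0 X) τ).comp
    ZeroAtInftyContinuousMap.isometry_toBCF.continuous

theorem hasCompactSupport_of_zero_of_le {g : ℝ≥0 → X} {b : ℝ≥0} (h : ∀ τ, b ≤ τ → g τ = 0) :
    HasCompactSupport g :=
  HasCompactSupport.intro (isCompact_Icc (a := 0) (b := b)) fun τ hτ =>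
    h τ (le_of_not_ge fun h' => hτ ⟨zero_le, h'⟩)
variable [NormedSpace ℂ X]

theorem C00.norm_le {f : C00 X} {c : ℝ} (hc : 0 ≤ c) :
    ‖f‖ ≤ c ↔ ∀ τ, ‖(f : C₀(ℝ≥0, X)) τ‖ ≤ c := by
  change ‖(f : C₀(ℝ≥0, X))‖ ≤ c ↔ _
  rw [← ZeroAtInftyContinuousMap.norm_toBCF_eq_norm, BoundedContinuousFunction.norm_le hc]
  rfl

theorem C00.norm_apply_le (f : C00 X) (τ : ℝ≥0) : ‖(f : C₀(ℝ≥0, X)) τ‖ ≤ ‖f‖ :=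
  (C00.norm_le (norm_nonneg f)).1 le_rfl τ

instance C00.completeSpace [CompleteSpace X] : CompleteSpace (C00 X) :=
  ((isClosed_singleton (x := (0 : X))).preimage
    (continuous_eval_zeroAtInfty (X := X) 0)).completeSpace_coe

theorem C00.exists_rep {g : ℝ≥0 → X} {b : ℝ≥0} (hg : Continuous g) (h0 : g 0 = 0)
    (hb : ∀ τ, b ≤ τ → g τ = 0) : ∃ f : C00 X, ((f : C₀(ℝ≥0, X)) : ℝ≥0 → X) = g :=
  ⟨⟨⟨⟨g, hg⟩, (hasCompactSupport_of_zero_of_le hb).is_zero_at_infty⟩, h0⟩, rfl⟩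

theorem isFunctionSpace_C00 : IsFunctionSpace (F := C00 X) ⊤ fun f => (f : C₀(ℝ≥0, X)) where
  ev_sub f g := .of_forall fun τ => rfl
  ev_smul c f := .of_forall fun τ => rfl
  ext f g h := Subtype.ext (DFunLike.coe_injective (eventuallyEq_top.1 h))
  exists_rep g b hg h0 hb := by
    obtain ⟨f, hf⟩ := C00.exists_rep hg h0 hb
    exact ⟨f, hf ▸ EventuallyEq.rfl⟩
  norm_le f a d c hc h _ _ := by
    refine ((C00.norm_le hc).2 (eventually_top.1 h)).trans ?_
    nlinarith [d.coe_nonneg]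
  le_norm f a c h :=
    (eventually_top.1 h a le_rfl (lt_add_one a)).trans (C00.norm_apply_le f a)
  isClosed_vanishing a := by
    simp only [eventually_top, Set.ofPred_forall]
    exact isClosed_iInter fun τ => isClosed_iInter fun _ =>
      (isClosed_singleton (x := (0 : X))).preimage
        ((continuous_eval_zeroAtInfty τ).comp continuous_subtype_val)
  dense := by
    refine Metric.dense_iff.2 fun f ε hε => ?_
    have hf : ∀ᶠ τ in atTop, ‖(f : C₀(ℝ≥0, X)) τ‖ < ε / 2 := by
      have := ((zero_at_infty (f : C₀(ℝ≥0, X))).mono_left atTop_le_cocompact).norm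
      exact this.eventually_lt_const (by simpa using hε)
    obtain ⟨b, hb⟩ := eventually_atTop.1 hf
    -- The smooth cutoff changes `f` only beyond `b`, where `f` is already smaller than `ε / 2`.
    set g : ℝ≥0 → X := fun τ =>
      ((1 - Real.smoothTransition (τ - b) : ℝ) : ℂ) • (f : C₀(ℝ≥0, X)) τ with hg
    have hgc : Continuous g := by
      have := Real.smoothTransition.continuous
      have := map_continuous (f : C₀(ℝ≥0, X))
      fun_prop
    have hg0 : g 0 = 0 := by
      have : (f : C₀(ℝ≥0, X)) 0 = 0 := f.2
      simp [hg, this]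
    have hgb : ∀ τ, b + 1 ≤ τ → g τ = 0 := fun τ hτ => by
      have : (b : ℝ) + 1 ≤ τ := by exact_mod_cast hτ
      simp only [hg]
      rw [Real.smoothTransition.one_of_one_le (by linarith)]
      simp
    obtain ⟨f', hf'⟩ := C00.exists_rep hgc hg0 hgb
    refine ⟨f', ?_, g, b + 1, hgc, hg0, hgb, hf' ▸ EventuallyEq.rfl⟩
    rw [Metric.mem_ball, dist_comm, dist_eq_norm]
    refine ((C00.norm_le (half_pos hε).le).2 fun τ => ?_).trans_lt (half_lt_self hε)
    change ‖(f : C₀(ℝ≥0, X)) τ - (f' : C₀(ℝ≥0, X)) τ‖ ≤ _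
    rw [hf']
    simp only [hg]
    nth_rw 1 [← one_smul ℂ ((f : C₀(ℝ≥0, X)) τ)]
    rw [← sub_smul, norm_smul, ← Complex.ofReal_one, ← Complex.ofReal_sub, sub_sub_cancel,
      Complex.norm_real, Real.norm_of_nonneg (Real.smoothTransition.nonneg _)]
    rcases le_total b τ with h | h
    · calc _ ≤ 1 * (ε / 2) :=
            mul_le_mul (Real.smoothTransition.le_one _) (hb τ h).le (norm_nonneg _) zero_le_one
        _ = _ := one_mul _
    · have : (τ : ℝ) ≤ b := by exact_mod_cast h
      rw [Real.smoothTransition.zero_of_nonpos (by linarith), zero_mul]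
      exact (half_pos hε).le

theorem isEvolution_evolC00 (𝒰 : EvolutionFamily X) (h𝒰 : 𝒰.ExponentiallyBounded) :
    IsEvolution 𝒰 ⊤ (fun f : C00 X => (f : C₀(ℝ≥0, X))) (evolC00 𝒰 h𝒰) where
  toIsFunctionSpace := isFunctionSpace_C00
  ev_apply t f := EventuallyEq.rfl
  evolFun_congr t f g h := by rw [eventuallyEq_top.1 h]
  norm_apply_le t C hC := ContinuousLinearMap.opNorm_le_bound _ C.coe_nonneg fun f =>
    (C00.norm_le (by positivity)).2 fun τ => norm_evolFun_le hC (C00.norm_apply_le f) τ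

end ContinuousFunctions

/-! ### The space `L^p(ℝ₊, X)` -/

section Lp

variable {X : Type*} [NormedAddCommGroup X]

theorem halfLineMeasure_apply (s : Set ℝ≥0) :
    halfLineMeasure s = volume (((↑) : ℝ≥0 → ℝ) '' s) :=
  measurableEmbedding_coe.comap_apply _ _

theorem halfLineMeasure_Ico (a b : ℝ≥0) :
    halfLineMeasure (Set.Ico a b) = ENNReal.ofReal (b - a) := by
  rw [halfLineMeasure_apply, NNReal.image_coe_Ico, Real.volume_Ico]

instance isFiniteMeasureOnCompacts_halfLineMeasure : IsFiniteMeasureOnCompacts halfLineMeasure :=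
  ⟨fun K hK => by
    rw [halfLineMeasure_apply]
    exact (hK.image NNReal.continuous_coe).measure_lt_top⟩

theorem eLpNorm_le_of_zero_off_Ico {f : ℝ≥0 → X} {a d : ℝ≥0} {c : ℝ} (p : ℝ≥0∞)
    (hc : ∀ᵐ τ ∂halfLineMeasure, ‖f τ‖ ≤ c) (ha : ∀ᵐ τ ∂halfLineMeasure, τ < a → f τ = 0)
    (hd : ∀ᵐ τ ∂halfLineMeasure, a + d ≤ τ → f τ = 0) :
    eLpNorm f p halfLineMeasure ≤ (d : ℝ≥0∞) ^ p.toReal⁻¹ * ENNReal.ofReal c := by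
  have h1 : f =ᵐ[halfLineMeasure] (Set.Ico a (a + d)).indicator f := by
    filter_upwards [ha, hd] with τ h1 h2
    by_cases h : τ ∈ Set.Ico a (a + d)
    · rw [Set.indicator_of_mem h]
    · rw [Set.indicator_of_notMem h]
      rcases lt_or_ge τ a with h' | h'
      · exact h1 h'
      · exact h2 (not_lt.1 fun h'' => h ⟨h', h''⟩)
  rw [eLpNorm_congr_ae h1, eLpNorm_indicator_eq_eLpNorm_restrict measurableSet_Ico]
  refine (eLpNorm_le_of_ae_bound (ae_restrict_of_ae hc)).trans (le_of_eq ?_)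
  rw [Measure.restrict_apply_univ, halfLineMeasure_Ico]
  simp

/-- Continuous functions with compact support that vanish at `0` are dense in `L^p`. -/
theorem exists_continuous_eLpNorm_sub_le [NormedSpace ℂ X] {p : ℝ≥0∞} (hp1 : 1 ≤ p)
    (hp : p ≠ ⊤) {f : ℝ≥0 → X}
    (hf : MemLp f p halfLineMeasure) {ε : ℝ≥0∞} (hε : ε ≠ 0) :
    ∃ (g : ℝ≥0 → X) (b : ℝ≥0), Continuous g ∧ g 0 = 0 ∧ (∀ τ, b ≤ τ → g τ = 0) ∧
      eLpNorm (f - g) p halfLineMeasure ≤ ε := by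
  have hε2 : ε / 2 ≠ 0 := (ENNReal.half_pos hε).ne'
  obtain ⟨k, hk, hfk, hkc, -⟩ := hf.exists_hasCompactSupport_eLpNorm_sub_le hp hε2
  obtain ⟨C, hC⟩ := hkc.bounded_above_of_compact_support hk
  have hq : 0 < p.toReal⁻¹ := inv_pos.2 (ENNReal.toReal_pos (zero_lt_one.trans_le hp1).ne' hp)
  -- The approximant `k` need not vanish at `0`. Forcing this by a cutoff on `[0, d)` costs at most
  -- `d^{1/p} C`, which is small because `1/p > 0`.
  obtain ⟨d, hd0, hd⟩ : ∃ d : ℝ≥0, 0 < d ∧ (d : ℝ≥0∞) ^ p.toReal⁻¹ * ENNReal.ofReal C ≤ ε / 2 := by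
    have h1 : Tendsto (fun d : ℝ≥0 => (d : ℝ≥0∞) ^ p.toReal⁻¹ * ENNReal.ofReal C) (𝓝[>] 0)
        (𝓝 0) := by
      have h2 : Tendsto (fun d : ℝ≥0 => (d : ℝ≥0∞) ^ p.toReal⁻¹) (𝓝 0) (𝓝 0) :=
        ((ENNReal.continuous_rpow_const (y := p.toReal⁻¹)).comp ENNReal.continuous_coe).tendsto' 0 0
          (by simp [hq])
      have h3 := ENNReal.Tendsto.mul_const (b := ENNReal.ofReal C) h2 (.inr ENNReal.ofReal_ne_top)
      rw [zero_mul] at h3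
      exact h3.mono_left nhdsWithin_le_nhds
    have h4 := h1.eventually_le_const (ENNReal.half_pos hε)
    obtain ⟨d, h5, h6⟩ := (h4.and self_mem_nhdsWithin).exists
    exact ⟨d, h6, h5⟩
  obtain ⟨b, hb⟩ := hk.isCompact.bddAbove
  have hd0' : (0 : ℝ) < d := hd0
  set g : ℝ≥0 → X := fun τ => ((Real.smoothTransition (τ / d) : ℝ) : ℂ) • k τ with hg
  have hgc : Continuous g := by
    have := Real.smoothTransition.continuous
    fun_prop
  refine ⟨g, b + 1, hgc, ?_, fun τ hτ => ?_, ?_⟩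
  · simp [hg]
  · have : τ ∉ tsupport k := fun h => (hτ.trans (hb h)).not_gt (lt_add_one b)
    simp [hg, image_eq_zero_of_notMem_tsupport this]
  · have hkg : eLpNorm (k - g) p halfLineMeasure ≤ ε / 2 := by
      have e : ∀ τ, (k - g) τ = ((1 - Real.smoothTransition (τ / d) : ℝ) : ℂ) • k τ := fun τ => by
        simp [hg, sub_smul]
      refine (eLpNorm_le_of_zero_off_Ico (a := 0) (d := d) (c := C) p (.of_forall fun τ => ?_)
        (.of_forall fun τ h => absurd h not_lt_zero) (.of_forall fun τ h => ?_)).trans hd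
      · rw [e, norm_smul, Complex.norm_real, Real.norm_of_nonneg
          (sub_nonneg.2 (Real.smoothTransition.le_one _))]
        refine (mul_le_of_le_one_left (norm_nonneg _) ?_).trans (hC τ)
        linarith [Real.smoothTransition.nonneg (τ / d)]
      · have h' : (d : ℝ) ≤ τ := by simpa using h
        rw [e, Real.smoothTransition.one_of_one_le ((one_le_div hd0').2 h')]
        simp
    calc eLpNorm (f - g) p halfLineMeasure = eLpNorm ((f - k) + (k - g)) p halfLineMeasure := by
          rw [sub_add_sub_cancel]
      _ ≤ eLpNorm (f - k) p halfLineMeasure + eLpNorm (k - g) p halfLineMeasure :=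
          eLpNorm_add_le (hf.aestronglyMeasurable.sub hkc.aestronglyMeasurable)
            (hkc.aestronglyMeasurable.sub hgc.aestronglyMeasurable) hp1
      _ ≤ ε / 2 + ε / 2 := add_le_add hfk hkg
      _ = ε := ENNReal.add_halves ε

variable [NormedSpace ℂ X]

theorem isFunctionSpace_Lp (p : ℝ≥0∞) [hp1 : Fact (1 ≤ p)] (hp : p ≠ ⊤) :
    IsFunctionSpace (F := Lp X p halfLineMeasure) (ae halfLineMeasure) fun f => f where
  ev_sub f g := Lp.coeFn_sub f g
  ev_smul c f := Lp.coeFn_smul c f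
  ext f g h := Lp.ext h
  exists_rep g b hg h0 hb :=
    ⟨(hg.memLp_of_hasCompactSupport (hasCompactSupport_of_zero_of_le hb)).toLp g,
      MemLp.coeFn_toLp _⟩
  norm_le f a d c hc h h1 h2 := by
    -- Enlarging the base to `1 + d ≥ 1` first makes the power monotone in the exponent, and `1/p ≤
    -- 1`.
    have hd : (d : ℝ≥0∞) ^ p.toReal⁻¹ ≤ 1 + d := by
      have hq0 : 0 ≤ p.toReal⁻¹ := by positivity
      have hq1 : p.toReal⁻¹ ≤ 1 := by
        refine inv_le_one_of_one_le₀ ?_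
        rw [← ENNReal.toReal_one]
        exact ENNReal.toReal_mono hp hp1.out
      calc (d : ℝ≥0∞) ^ p.toReal⁻¹ ≤ (1 + d : ℝ≥0∞) ^ p.toReal⁻¹ :=
            ENNReal.rpow_le_rpow le_add_self hq0
        _ ≤ (1 + d : ℝ≥0∞) ^ (1 : ℝ) := ENNReal.rpow_le_rpow_of_exponent_le le_self_add hq1
        _ = _ := ENNReal.rpow_one _
    rw [Lp.norm_def]
    refine ENNReal.toReal_le_of_le_ofReal (by positivity)
      ((eLpNorm_le_of_zero_off_Ico p h h1 h2).trans ?_)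
    rw [ENNReal.ofReal_mul (by positivity), ENNReal.ofReal_add zero_le_one d.coe_nonneg]
    gcongr
    simpa using hd
  le_norm f a c h := by
    rcases le_or_gt c 0 with hc | hc
    · exact hc.trans (norm_nonneg _)
    have h1 : eLpNorm ((Set.Ico a (a + 1)).indicator fun _ => c) p halfLineMeasure
        ≤ eLpNorm f p halfLineMeasure := by
      refine eLpNorm_mono_ae ?_
      filter_upwards [h] with τ h
      by_cases hτ : τ ∈ Set.Ico a (a + 1)
      · rw [Set.indicator_of_mem hτ, Real.norm_of_nonneg hc.le]
        exact h hτ.1 hτ.2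
      · rw [Set.indicator_of_notMem hτ, norm_zero]
        exact norm_nonneg _
    rw [eLpNorm_indicator_const measurableSet_Ico (zero_lt_one.trans_le hp1.out).ne' hp,
      halfLineMeasure_Ico] at h1
    have h2 : ENNReal.ofReal c ≤ eLpNorm f p halfLineMeasure := by
      rw [← Real.enorm_of_nonneg hc.le]
      simpa using h1
    rw [Lp.norm_def]
    exact (ENNReal.ofReal_le_iff_le_toReal (Lp.eLpNorm_ne_top f)).1 h2
  isClosed_vanishing a := by
    -- Closedness comes from writing the set as the kernel of the bounded restriction map to `[0,
    -- a)`.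
    have : {f : Lp X p halfLineMeasure | ∀ᵐ τ ∂halfLineMeasure, τ < a → f τ = 0} =
        LpToLpRestrictCLM ℝ≥0 X ℂ halfLineMeasure p (Set.Iio a) ⁻¹' {0} := by
      ext f
      have h1 := LpToLpRestrictCLM_coeFn ℂ (Set.Iio a) f
      rw [Set.mem_preimage, Set.mem_singleton_iff, Lp.eq_zero_iff_ae_eq_zero]
      change (∀ᵐ τ ∂halfLineMeasure, τ ∈ Set.Iio a → f τ = 0) ↔ _
      rw [← ae_restrict_iff' measurableSet_Iio]
      exact ⟨fun h => h1.trans h, fun h => h1.symm.trans h⟩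
    rw [this]
    exact isClosed_singleton.preimage (ContinuousLinearMap.continuous _)
  dense := by
    refine Metric.dense_iff.2 fun f ε hε => ?_
    obtain ⟨g, b, hgc, hg0, hgb, hg⟩ := exists_continuous_eLpNorm_sub_le hp1.out hp (Lp.memLp f)
      (ε := ENNReal.ofReal (ε / 2)) (by simpa using hε)
    have hm : MemLp g p halfLineMeasure :=
      hgc.memLp_of_hasCompactSupport (hasCompactSupport_of_zero_of_le hgb)
    refine ⟨hm.toLp g, ?_, g, b, hgc, hg0, hgb, MemLp.coeFn_toLp hm⟩
    rw [Metric.mem_ball, dist_comm, dist_eq_norm, Lp.norm_def]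
    have e : ⇑(f - hm.toLp g) =ᵐ[halfLineMeasure] ⇑f - g :=
      (Lp.coeFn_sub _ _).trans (EventuallyEq.rfl.sub (MemLp.coeFn_toLp hm))
    rw [eLpNorm_congr_ae e]
    exact (ENNReal.toReal_le_of_le_ofReal (half_pos hε).le hg).trans_lt (half_lt_self hε)

theorem isEvolution_evolLp (𝒰 : EvolutionFamily X) (h𝒰 : 𝒰.ExponentiallyBounded) (p : ℝ≥0∞)
    [hp1 : Fact (1 ≤ p)] (hp : p ≠ ⊤) :
    IsEvolution 𝒰 (ae halfLineMeasure) (fun f : Lp X p halfLineMeasure => f)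
      (evolLp 𝒰 h𝒰 p) where
  toIsFunctionSpace := isFunctionSpace_Lp p hp
  ev_apply t f := evolLp_coeFn 𝒰 h𝒰 p t f
  evolFun_congr t f g h := evolFun_congr_ae 𝒰 t h
  norm_apply_le t C hC := ContinuousLinearMap.opNorm_le_bound _ C.coe_nonneg fun f => by
    rw [Lp.norm_def, Lp.norm_def, ← ENNReal.coe_toReal, ← ENNReal.toReal_mul,
      eLpNorm_congr_ae (evolLp_coeFn 𝒰 h𝒰 p t f)]
    exact ENNReal.toReal_mono (ENNReal.mul_ne_top ENNReal.coe_ne_top (Lp.eLpNorm_ne_top f))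
      (eLpNorm_evolFun_le h𝒰 hC (Lp.memLp f))

end Lp

end EvolutionSemigroup

end

/-! ### The theorem for the two concrete spaces. -/

theorem theorem2p1 {X : Type*} [NormedAddCommGroup X] [NormedSpace ℂ X] [CompleteSpace X]
    [Nontrivial X] (𝒰 : EvolutionSemigroup.EvolutionFamily X) (h𝒰 : 𝒰.ExponentiallyBounded) :
    -- the case `ℱ = C₀₀(ℝ₊, X)`
    ((∃ s : EReal, s < ⊤ ∧
        EvolutionSemigroup.operatorSpectrum
          (EvolutionSemigroup.generator (EvolutionSemigroup.evolC00 𝒰 h𝒰)) =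
            {z : ℂ | (z.re : EReal) ≤ s}) ∧
      (∀ t : ℝ≥0, 0 < t → ∃ r : ℝ, 0 ≤ r ∧
        spectrum ℂ (EvolutionSemigroup.evolC00 𝒰 h𝒰 t) = Metric.closedBall (0 : ℂ) r) ∧
      (∀ t : ℝ≥0, 0 < t →
        (fun z : ℂ => Complex.exp (((t : ℝ) : ℂ) * z)) ''
          EvolutionSemigroup.operatorSpectrum
            (EvolutionSemigroup.generator (EvolutionSemigroup.evolC00 𝒰 h𝒰)) =
          spectrum ℂ (EvolutionSemigroup.evolC00 𝒰 h𝒰 t) \ {0})) ∧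
    -- the case `ℱ = L^p(ℝ₊, X)`, `1 ≤ p < ∞`
    (∀ (p : ℝ≥0∞) [Fact (1 ≤ p)], p ≠ ⊤ →
      (∃ s : EReal, s < ⊤ ∧
        EvolutionSemigroup.operatorSpectrum
          (EvolutionSemigroup.generator (EvolutionSemigroup.evolLp 𝒰 h𝒰 p)) =
            {z : ℂ | (z.re : EReal) ≤ s}) ∧
      (∀ t : ℝ≥0, 0 < t → ∃ r : ℝ, 0 ≤ r ∧
        spectrum ℂ (EvolutionSemigroup.evolLp 𝒰 h𝒰 p t) = Metric.closedBall (0 : ℂ) r) ∧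
      (∀ t : ℝ≥0, 0 < t →
        (fun z : ℂ => Complex.exp (((t : ℝ) : ℂ) * z)) ''
          EvolutionSemigroup.operatorSpectrum
            (EvolutionSemigroup.generator (EvolutionSemigroup.evolLp 𝒰 h𝒰 p)) =
          spectrum ℂ (EvolutionSemigroup.evolLp 𝒰 h𝒰 p t) \ {0})) := by
  have h0 := EvolutionSemigroup.isEvolution_evolC00 𝒰 h𝒰
  refine ⟨⟨h0.exists_operatorSpectrum_eq h𝒰, fun t ht => h0.exists_spectrum_eq_closedBall h𝒰 ht,
    fun t ht => h0.image_exp_operatorSpectrum h𝒰 ht⟩, fun p _ hp => ?_⟩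
  have h1 := EvolutionSemigroup.isEvolution_evolLp 𝒰 h𝒰 p hp
  exact ⟨h1.exists_operatorSpectrum_eq h𝒰, fun t ht => h1.exists_spectrum_eq_closedBall h𝒰 ht,
    fun t ht => h1.image_exp_operatorSpectrum h𝒰 ht⟩
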